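/- Let $\hbar>0$, $I_1>0$, $\delta,c_1,c_2\in\mathbb R$ and $m,k\in\mathbb Z$. In Euler angles $(\phi,\theta,\psi)$, $R=R_z(\phi)R_x(\theta)R_z(\psi)$, put $\hat l_z=-i\partial_\phi$, $\hat L_3=-i\partial_\psi$, $$\hat{\boldsymbol l}^2=-\frac1{\sin\theta}\partial_\theta(\sin\theta\,\partial_\theta)+\frac1{\sin^2\theta}\left(\hat l_z^2+\hat L_3^2-2\cos\theta\,\hat l_z\hat L_3\right),$$ and let the Hamiltonian of the harmonic Lagrange top be $$\hat H=\frac{\hbar^2}{2I_1}\left(\hat{\boldsymbol l}^2+\delta\hat L_3^2\right)+c_1\cos\theta+c_2\cos^2\theta .$$ On wave functions $e^{i(m\phi+k\psi)}f(\theta)$, where $\hat l_z=m$ and $\hat L_3=k$, it acts on $f$ as the operator $\hat H_{m,k}$ obtained by replacing $\hat l_z,\hat L_3$ by $m,k$. With $z=\cos\theta$, $\tilde c_i=2I_1c_i/\hbar^2$ and $\lambda=2I_1E/\hbar^2-\delta k^2$, the equation $\hat H_{m,k}f=Ef$ is equivalent to the confluent Heun equation $$-\partial_z\left((1-z^2)\partial_z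 u\right)+\left(\frac{k^2+m^2-2kmz}{1-z^2}+\tilde c_1z+\tilde c_2z^2-\lambda\right)u=0,\qquad f(\theta)=u(\cos\theta).$$ For integers $j\ge\max(|m|,|k|)$ let $\Phi_j$ be the $\theta$-factor of the normalised Wigner $D$-function, $$\Phi_j(\theta)=(-1)^jN_j\,\sin^{|m-k|}\tfrac\theta2\,\cos^{|m+k|}\tfrac\theta2\;P^{(|m-k|,|m+k|)}_{j-\max(|m|,|k|)}(\cos\theta),$$ where $P_n^{(a,b)}$ is the Jacobi polynomial and $N_j>0$ normalises $\Phi_j$ in $L^2((0,\pi),\sin\theta\,d\theta)$. The functions $e^{i(m\phi+k\psi)}\Phi_j(\theta)$ are joint eigenfunctions of $\hat l_z,\hat L_3,\hat{\boldsymbol l}^2$ with eigenvalues $m,k,j(j+1)$, and $(\Phi_j)_j$ is an orthonormal basis of $L^2((0,\pi),\sin\theta\,d\theta)$. The operator $\hat H_{m,k}$, initially defined on all functions that are $C^2$ on the closed interval $[0,\pi]$ and that it maps into $L^2(\sin\theta\,d\theta)$, is closable and its closure is self-adjoint. In the basis $(\Phi_j)$ this self-adjoint operator is represented, domains included, by the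 maximal operator on $\ell^2$ of the infinite real symmetric pentadiagonal matrix $$\hat H=\hat H_0+c_1\hat H_1+c_2\hat H_1^2 .$$ Here $\hat H_0$ is the diagonal matrix of the Hamiltonian without potential, with entries $\frac{\hbar^2}{2I_1}(j(j+1)+\delta k^2)$, and $\hat H_1$ is the tridiagonal matrix of $\cos\theta$, with diagonal entries $a_j=\dfrac{km}{j(j+1)}$ ($a_0=0$ if $m=k=0$) and off-diagonal entries, in the positions $(j-1,j)$ and $(j,j-1)$, $$b_j=-\sqrt{\frac{(j^2-k^2)(j^2-m^2)}{j^2(4j^2-1)}} .$$ The matrix $\hat H_1^2$ is the matrix of $\cos^2\theta$, and the entries of $\hat H$ in the positions $(j,j+2)$ are $c_2b_{j+1}b_{j+2}$. The spectrum of $\hat H_{m,k}$ equals the spectrum of this matrix in $\ell^2$, and it is exactly the set of the eigenvalues of the matrix with eigenvectors in $\ell^2$. -/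

import Mathlib

namespace HarmonicTop

noncomputable section

open MeasureTheory

/-! ### The Hamiltonian in Euler angles -/

/-- A wave function in the Euler angles `(φ, θ, ψ)` with `R = R_z(φ) R_x(θ) R_z(ψ)`. -/
abbrev EulerFun : Type := ℝ → ℝ → ℝ → ℂ

/-- The space-fixed vertical angular momentum `-i ∂/∂φ` (in units of `ħ`). -/
def lz (Ψ : EulerFun) : EulerFun :=
  fun φ θ ψ => -Complex.I * deriv (fun t => Ψ t θ ψ) φ

/-- The angular momentum `-i ∂/∂ψ` about the figure axis (in units of `ħ`). -/
def L3 (Ψ : EulerFun) : EulerFun :=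
  fun φ θ ψ => -Complex.I * deriv (fun t => Ψ φ θ t) ψ

/-- The total angular momentum operator: minus the Laplace-Beltrami operator of the round metric
of `SO(3)`, whose inverse metric is
`p_θ² + (p_φ² + p_ψ² - 2 p_φ p_ψ cos θ) / sin² θ`. -/
def lSq (Ψ : EulerFun) : EulerFun :=
  fun φ θ ψ =>
    -(1 / (Real.sin θ : ℂ)) *
        deriv (fun t => (Real.sin t : ℂ) * deriv (fun s => Ψ φ s ψ) t) θ
      + 1 / (Real.sin θ : ℂ) ^ 2 *
        (lz (lz Ψ) φ θ ψ + L3 (L3 Ψ) φ θ ψ - 2 * (Real.cos θ : ℂ) * lz (L3 Ψ) φ θ ψ)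

/-- The Hamiltonian `ħ²/(2 I₁) (l² + δ L₃²) + c₁ cos θ + c₂ cos² θ` of the harmonic Lagrange
top. -/
def topHamiltonian (ħ I₁ δ c₁ c₂ : ℝ) (Ψ : EulerFun) : EulerFun :=
  fun φ θ ψ =>
    ((ħ ^ 2 / (2 * I₁) : ℝ) : ℂ) * (lSq Ψ φ θ ψ + (δ : ℂ) * L3 (L3 Ψ) φ θ ψ)
      + ((c₁ * Real.cos θ + c₂ * Real.cos θ ^ 2 : ℝ) : ℂ) * Ψ φ θ ψ

/-- The wave function `e^{i(mφ + kψ)} f(θ)`. -/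
def sectorFun (m k : ℤ) (f : ℝ → ℂ) : EulerFun :=
  fun φ θ ψ => Complex.exp (Complex.I * ((m : ℂ) * (φ : ℂ) + (k : ℂ) * (ψ : ℂ))) * f θ

/-! ### The reduced operators for fixed `m`, `k` -/

/-- The total angular momentum operator for fixed `m`, `k`, acting on functions of `θ`. -/
def lSqReduced (m k : ℤ) (u : ℝ → ℂ) : ℝ → ℂ :=
  fun θ =>
    -(1 / (Real.sin θ : ℂ)) * deriv (fun t => (Real.sin t : ℂ) * deriv u t) θ
      + (((m : ℝ) ^ 2 + (k : ℝ) ^ 2 - 2 * m * k * Real.cos θ) / Real.sin θ ^ 2 : ℝ) * u θ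

/-- The Hamiltonian for fixed `m`, `k` as a differential expression in `θ`. -/
def reducedHamiltonian (ħ I₁ δ c₁ c₂ : ℝ) (m k : ℤ) (u : ℝ → ℂ) : ℝ → ℂ :=
  fun θ =>
    ((ħ ^ 2 / (2 * I₁) : ℝ) : ℂ) * (lSqReduced m k u θ + ((δ * (k : ℝ) ^ 2 : ℝ) : ℂ) * u θ)
      + ((c₁ * Real.cos θ + c₂ * Real.cos θ ^ 2 : ℝ) : ℂ) * u θ

/-- The left-hand side of the confluent Heun equation in self-adjoint form,
`-((1 - z²) u')' + ((k² + m² - 2kmz)/(1 - z²) + γ₁ z + γ₂ z² - lam) u`. -/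
def heunOperator (m k : ℤ) (γ₁ γ₂ : ℝ) (lam : ℂ) (u : ℝ → ℂ) : ℝ → ℂ :=
  fun z =>
    -deriv (fun t => ((1 - t ^ 2 : ℝ) : ℂ) * deriv u t) z
      + (((((k : ℝ) ^ 2 + (m : ℝ) ^ 2 - 2 * k * m * z) / (1 - z ^ 2) + γ₁ * z + γ₂ * z ^ 2 : ℝ) : ℂ)
          - lam) * u z

/-- The measure `sin θ dθ` on `(0, π)`. -/
def thetaMeasure : Measure ℝ :=
  (volume.restrict (Set.Ioo 0 Real.pi)).withDensity (fun θ => ENNReal.ofReal (Real.sin θ))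

/-- The Hilbert space `L²((0, π), sin θ dθ)`. -/
abbrev Wave : Type := Lp ℂ 2 thetaMeasure

section Linearity

variable {ħ I₁ δ c₁ c₂ : ℝ} {m k : ℤ}

theorem hasDeriv_sin_mul_deriv {u : ℝ → ℂ} (hu : ContDiff ℝ 2 u) :
    Differentiable ℝ (fun t => (Real.sin t : ℂ) * deriv u t) := by
  have h1 : Differentiable ℝ (deriv u) :=
    ((contDiff_succ_iff_deriv (n := 1)).1 hu).2.2.differentiable one_ne_zero
  have h2 : Differentiable ℝ (fun t : ℝ => (Real.sin t : ℂ)) := fun t =>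
    (Real.hasDerivAt_sin t).ofReal_comp.differentiableAt
  exact h2.mul h1

theorem reducedHamiltonian_add {u v : ℝ → ℂ} (hu : ContDiff ℝ 2 u) (hv : ContDiff ℝ 2 v) :
    reducedHamiltonian ħ I₁ δ c₁ c₂ m k (u + v) =
      reducedHamiltonian ħ I₁ δ c₁ c₂ m k u + reducedHamiltonian ħ I₁ δ c₁ c₂ m k v := by
  have hd : deriv (u + v) = deriv u + deriv v := by
    funext t
    exact deriv_add (hu.differentiable two_ne_zero t) (hv.differentiable two_ne_zero t)
  funext θ
  have h : deriv (fun t => (Real.sin t : ℂ) * deriv (u + v) t) θ =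
      deriv (fun t => (Real.sin t : ℂ) * deriv u t) θ
        + deriv (fun t => (Real.sin t : ℂ) * deriv v t) θ := by
    rw [← deriv_fun_add (hasDeriv_sin_mul_deriv hu θ) (hasDeriv_sin_mul_deriv hv θ), hd]
    congr 1
    funext t
    simp only [Pi.add_apply, mul_add]
  simp only [reducedHamiltonian, lSqReduced, Pi.add_apply, h]
  ring

theorem reducedHamiltonian_smul (c : ℂ) (u : ℝ → ℂ) :
    reducedHamiltonian ħ I₁ δ c₁ c₂ m k (c • u) =
      c • reducedHamiltonian ħ I₁ δ c₁ c₂ m k u := by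
  have hd : deriv (c • u) = c • deriv u := by
    funext t
    exact deriv_const_mul_field c
  funext θ
  have h : deriv (fun t => (Real.sin t : ℂ) * deriv (c • u) t) θ =
      c * deriv (fun t => (Real.sin t : ℂ) * deriv u t) θ := by
    rw [← deriv_const_mul_field c, hd]
    congr 1
    funext t
    simp only [Pi.smul_apply, smul_eq_mul]
    ring
  simp only [reducedHamiltonian, lSqReduced, Pi.smul_apply, smul_eq_mul, h]
  ring

end Linearity

/-- The graph of the reduced Hamiltonian on its natural initial domain: all `f` that are given by a
function `u` which is twice continuously differentiable up to the end points of `[0, π]` and whose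
image under the differential expression is again square integrable. -/
def initialGraph (ħ I₁ δ c₁ c₂ : ℝ) (m k : ℤ) : Submodule ℂ (Wave × Wave) where
  carrier := {p | ∃ u : ℝ → ℂ, ContDiff ℝ 2 u ∧ (p.1 : ℝ → ℂ) =ᵐ[thetaMeasure] u ∧
    (p.2 : ℝ → ℂ) =ᵐ[thetaMeasure] reducedHamiltonian ħ I₁ δ c₁ c₂ m k u}
  zero_mem' := by
    refine ⟨0, contDiff_const, Lp.coeFn_zero ℂ 2 thetaMeasure, ?_⟩
    have h := reducedHamiltonian_smul (ħ := ħ) (I₁ := I₁) (δ := δ) (c₁ := c₁) (c₂ := c₂)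
      (m := m) (k := k) 0 0
    rw [zero_smul, zero_smul] at h
    rw [h]
    exact Lp.coeFn_zero ℂ 2 thetaMeasure
  add_mem' := by
    rintro ⟨f, g⟩ ⟨f', g'⟩ ⟨u, hu, hf, hg⟩ ⟨v, hv, hf', hg'⟩
    refine ⟨u + v, hu.add hv, (Lp.coeFn_add f f').trans (hf.add hf'), ?_⟩
    rw [reducedHamiltonian_add hu hv]
    exact (Lp.coeFn_add g g').trans (hg.add hg')
  smul_mem' := by
    rintro c ⟨f, g⟩ ⟨u, hu, hf, hg⟩
    refine ⟨c • u, contDiff_const.smul hu, (Lp.coeFn_smul c f).trans (hf.const_smul c), ?_⟩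
    rw [reducedHamiltonian_smul]
    exact (Lp.coeFn_smul c g).trans (hg.const_smul c)

/-- Two continuous functions that agree almost everywhere for `sin θ dθ` agree on `(0, π)`. -/
theorem eqOn_of_ae_eq {u v : ℝ → ℂ} (hu : Continuous u) (hv : Continuous v)
    (h : u =ᵐ[thetaMeasure] v) : Set.EqOn u v (Set.Ioo 0 Real.pi) := by
  have h1 : u =ᵐ[volume.restrict (Set.Ioo 0 Real.pi)] v := by
    have h2 := (ae_withDensity_iff (μ := volume.restrict (Set.Ioo 0 Real.pi))
      (f := fun θ => ENNReal.ofReal (Real.sin θ))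
      (ENNReal.measurable_ofReal.comp Real.measurable_sin)).1 h
    filter_upwards [h2, ae_restrict_mem measurableSet_Ioo] with θ hθ hm
    exact hθ (by simpa using Real.sin_pos_of_pos_of_lt_pi hm.1 hm.2)
  exact Measure.eqOn_open_of_ae_eq h1 isOpen_Ioo hu.continuousOn hv.continuousOn

/-- The differential expression is well defined on classes of functions. -/
theorem initialGraph_single_valued (ħ I₁ δ c₁ c₂ : ℝ) (m k : ℤ) :
    ∀ p ∈ initialGraph ħ I₁ δ c₁ c₂ m k, p.1 = 0 → p.2 = 0 := by
  rintro ⟨f, g⟩ ⟨u, hu, hf, hg⟩ h0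
  simp only at hf hg h0
  subst h0
  have hz : Set.EqOn u 0 (Set.Ioo 0 Real.pi) :=
    eqOn_of_ae_eq hu.continuous continuous_const
      (hf.symm.trans (Lp.coeFn_zero ℂ 2 thetaMeasure))
  have hd : Set.EqOn (deriv u) 0 (Set.Ioo 0 Real.pi) := by
    intro t ht
    have : u =ᶠ[nhds t] fun _ => (0 : ℂ) :=
      Filter.eventuallyEq_of_mem (isOpen_Ioo.mem_nhds ht) hz
    rw [this.deriv_eq]
    simp
  have hdd : ∀ θ ∈ Set.Ioo 0 Real.pi,
      deriv (fun t => (Real.sin t : ℂ) * deriv u t) θ = 0 := by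
    intro t ht
    have : (fun t => (Real.sin t : ℂ) * deriv u t) =ᶠ[nhds t] fun _ => (0 : ℂ) :=
      Filter.eventuallyEq_of_mem (isOpen_Ioo.mem_nhds ht)
        (fun s hs => by simp [hd hs])
    rw [this.deriv_eq]
    simp
  have hmem : ∀ᵐ θ ∂thetaMeasure, θ ∈ Set.Ioo 0 Real.pi :=
    (withDensity_absolutelyContinuous _ _).ae_le (ae_restrict_mem measurableSet_Ioo)
  apply Lp.ext
  filter_upwards [hg, Lp.coeFn_zero ℂ 2 thetaMeasure, hmem] with θ h1 h2 h3
  rw [h1, h2]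
  simp only [reducedHamiltonian, lSqReduced, hdd θ h3, hz h3]
  simp

/-- The reduced Hamiltonian on its natural initial domain. -/
def initialHamiltonian (ħ I₁ δ c₁ c₂ : ℝ) (m k : ℤ) : Wave →ₗ.[ℂ] Wave :=
  (initialGraph ħ I₁ δ c₁ c₂ m k).toLinearPMap

/-- The Hamiltonian for fixed `m`, `k` as an unbounded operator: the closure of the differential
operator on its initial domain. -/
def hamiltonian (ħ I₁ δ c₁ c₂ : ℝ) (m k : ℤ) : Wave →ₗ.[ℂ] Wave :=
  (initialHamiltonian ħ I₁ δ c₁ c₂ m k).closure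

/-- The spectrum of an unbounded operator: the complement of the set of all `z` for which `A - z`
has an everywhere defined bounded inverse. -/
def spectrumOf {E : Type*} [NormedAddCommGroup E] [NormedSpace ℂ E] (A : E →ₗ.[ℂ] E) : Set ℂ :=
  {z | ∃ R : E →L[ℂ] E,
    (∀ y : E, ∃ h : R y ∈ A.domain, A ⟨R y, h⟩ - z • R y = y) ∧
    (∀ x : A.domain, R (A x - z • (x : E)) = x)}ᶜ

/-! ### The Wigner basis -/

/-- The Jacobi polynomial `P_n^{(a,b)}` for natural numbers `a`, `b`. -/
def jacobiP (n a b : ℕ) (x : ℝ) : ℝ :=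
  ∑ s ∈ Finset.range (n + 1),
    ((n + a).choose (n - s) : ℝ) * ((n + b).choose s : ℝ)
      * ((x - 1) / 2) ^ s * ((x + 1) / 2) ^ (n - s)

/-- The possible total angular momenta `j ≥ max(|m|, |k|)` for given `m`, `k`. -/
abbrev Level (m k : ℤ) : Type := {j : ℕ // max m.natAbs k.natAbs ≤ j}

/-- The `θ`-dependent factor of the Wigner `D`-function, normalised in `L²(sin θ dθ)` and with the
phase factor `(-1)^j`. -/
def wignerTheta (m k : ℤ) (j : ℕ) (θ : ℝ) : ℝ :=
  let a := (m - k).natAbs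
  let b := (m + k).natAbs
  let n := j - max m.natAbs k.natAbs
  (-1) ^ j
    * √((2 * (j : ℝ) + 1) / 2 * (((n.factorial : ℝ) * ((n + a + b).factorial : ℝ))
        / (((n + a).factorial : ℝ) * ((n + b).factorial : ℝ))))
    * Real.sin (θ / 2) ^ a * Real.cos (θ / 2) ^ b * jacobiP n a b (Real.cos θ)

/-- The Wigner `D`-function `e^{i(mφ + kψ)} d(θ)` as a function of the Euler angles. -/
def wignerD (m k : ℤ) (j : ℕ) : EulerFun :=
  sectorFun m k (fun θ => (wignerTheta m k j θ : ℂ))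

/-! ### The infinite matrices -/

/-- The matrix of the Hamiltonian without potential. -/
def H0 (ħ I₁ δ : ℝ) (m k : ℤ) : Matrix (Level m k) (Level m k) ℝ :=
  Matrix.diagonal fun j =>
    ħ ^ 2 / (2 * I₁) * ((j.1 : ℝ) * ((j.1 : ℝ) + 1) + δ * (k : ℝ) ^ 2)

/-- The diagonal entries of the matrix of `cos θ` (for `j = 0`, where `m = k = 0`, this is `0`). -/
def diagEntry (m k : ℤ) (j : ℕ) : ℝ :=
  (k : ℝ) * m / ((j : ℝ) * ((j : ℝ) + 1))

/-- The entry of the matrix of `cos θ` in the positions `(j - 1, j)` and `(j, j - 1)`. -/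
def offDiagEntry (m k : ℤ) (j : ℕ) : ℝ :=
  -√((((j : ℝ) ^ 2 - (k : ℝ) ^ 2) * ((j : ℝ) ^ 2 - (m : ℝ) ^ 2))
      / ((j : ℝ) ^ 2 * (4 * (j : ℝ) ^ 2 - 1)))

/-- The tridiagonal matrix of `cos θ`. -/
def H1 (m k : ℤ) : Matrix (Level m k) (Level m k) ℝ :=
  Matrix.of fun i j =>
    if i.1 = j.1 then diagEntry m k j.1
    else if i.1 + 1 = j.1 then offDiagEntry m k j.1
    else if j.1 + 1 = i.1 then offDiagEntry m k i.1
    else 0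

/-- The square of the infinite matrix `H1` (each of the sums has at most three nonzero terms). -/
def H1sq (m k : ℤ) : Matrix (Level m k) (Level m k) ℝ :=
  Matrix.of fun i j => ∑ᶠ l, H1 m k i l * H1 m k l j

/-- The infinite matrix `H0 + c₁ H1 + c₂ H1²`. -/
def topMatrix (ħ I₁ δ c₁ c₂ : ℝ) (m k : ℤ) : Matrix (Level m k) (Level m k) ℝ :=
  H0 ħ I₁ δ m k + c₁ • H1 m k + c₂ • H1sq m k

/-- The graph of the operator `x ↦ M x` in `ℓ²` given by an infinite matrix `M` on its maximal
domain. -/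
def matrixGraph {ι : Type*} (M : Matrix ι ι ℝ) :
    Submodule ℂ (lp (fun _ : ι => ℂ) 2 × lp (fun _ : ι => ℂ) 2) where
  carrier := {p | ∀ i, HasSum (fun j => (M i j : ℂ) * p.1 j) (p.2 i)}
  zero_mem' := by
    intro i
    simp
  add_mem' := by
    intro p q hp hq i
    simpa [mul_add] using (hp i).add (hq i)
  smul_mem' := by
    intro c p hp i
    simpa [mul_left_comm] using (hp i).mul_left c

theorem matrixGraph_single_valued {ι : Type*} (M : Matrix ι ι ℝ) :
    ∀ p ∈ matrixGraph M, p.1 = 0 → p.2 = 0 := by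
  intro p hp h0
  ext i
  have h := hp i
  rw [h0] at h
  simp only [lp.coeFn_zero, Pi.zero_apply, mul_zero] at h
  simpa using h.unique hasSum_zero

/-- The operator `x ↦ M x` in `ℓ²` on its maximal domain. -/
def matrixOperator {ι : Type*} (M : Matrix ι ι ℝ) :
    lp (fun _ : ι => ℂ) 2 →ₗ.[ℂ] lp (fun _ : ι => ℂ) 2 :=
  (matrixGraph M).toLinearPMap

end

end HarmonicTop

open HarmonicTop

/-! For fixed `m`, `k` the Hamiltonian is `D + V`: `D` is the free rotor, diagonal in the Wigner
functions with real entries `freeLevel` growing like `j²`, and `V` is multiplication by the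
potential, which is bounded and symmetric. Everything about the operator follows from this form.

Abstractly, the graph of `D + V` with maximal domain is described coefficient by coefficient
(`perturbedDiagGraph`). It is closed, it is its own adjoint (`adjoint_perturbedDiagGraph`), and
finite combinations of basis vectors are a core. Hence any operator whose graph lies inside it and
contains the pairs of the basis vectors has it as closure (`closure_graph_eq`). Each row of the
matrix of `D + V` gives a convergent series on every vector, so membership in the graph is exactly
the matrix equation in `ℓ²`. If `(D - μ)⁻¹` has summable entries, it is a compact operator `K`; then
`(T - z) x = y` reads `x + K W x = K y` with `W` bounded, and the Fredholm alternative makes each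
spectral point an eigenvalue (`mem_spectrumOf_iff_eigenvalue`).

For the top, the Wigner functions are `C²` on the whole line and satisfy the eigenvalue equation of
`l²` (`lSqReduced_wignerCore`), so they lie in the initial domain. Conversely, integrating
Lagrange's identity, where the factor `sin θ` kills the boundary terms, shows that each function of
the initial domain has the right coefficients (`inner_wignerWave_of_mem_initialGraph`).

The basis property rests on the three-term recurrence of the Jacobi polynomials, which is also the
matrix of `cos θ`. Orthogonality comes from distinct eigenvalues; symmetry of `cos θ` makes all
norms equal, and the lowest norm is a beta integral; completeness is Weierstrass approximation in
`cos θ`, because the lowest Wigner function has no zero in `(0, π)`. The matrix of `cos² θ` is then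
the square of that of `cos θ` by Parseval. -/

namespace HarmonicTop

noncomputable section

open MeasureTheory

/-! ### Bounded symmetric perturbations of a diagonal operator in a Hilbert basis. -/

section DiagonalPerturbation

open scoped InnerProductSpace

variable {ι E : Type*} [NormedAddCommGroup E] [InnerProductSpace ℂ E]

/-- The graph of `D + V`, where `D` is the maximal diagonal operator with entries `d` in the
Hilbert basis `b`. -/
def perturbedDiagGraph (b : HilbertBasis ι ℂ E) (d : ι → ℝ) (V : E →L[ℂ] E) :
    Submodule ℂ (E × E) where
  carrier := {p | ∀ j, ⟪b j, p.2⟫_ℂ = d j * ⟪b j, p.1⟫_ℂ + ⟪b j, V p.1⟫_ℂ}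
  zero_mem' := by simp
  add_mem' := by
    intro p q hp hq j
    simp only [Prod.fst_add, Prod.snd_add, inner_add_right, map_add, hp j, hq j]
    ring
  smul_mem' := by
    intro c p hp j
    simp only [Prod.smul_fst, Prod.smul_snd, inner_smul_right, map_smul, hp j]
    ring

variable {b : HilbertBasis ι ℂ E} {d : ι → ℝ} {V : E →L[ℂ] E}

theorem mem_perturbedDiagGraph {f g : E} :
    (f, g) ∈ perturbedDiagGraph b d V ↔
      ∀ j, ⟪b j, g⟫_ℂ = d j * ⟪b j, f⟫_ℂ + ⟪b j, V f⟫_ℂ := Iff.rfl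

theorem eq_of_inner_basis_eq (b : HilbertBasis ι ℂ E) {x y : E}
    (h : ∀ j, ⟪b j, x⟫_ℂ = ⟪b j, y⟫_ℂ) : x = y := by
  apply b.repr.injective
  ext j
  rw [b.repr_apply_apply, b.repr_apply_apply, h j]

theorem inner_basis_eq_ite [DecidableEq ι] (b : HilbertBasis ι ℂ E) (i j : ι) :
    ⟪b i, b j⟫_ℂ = if i = j then 1 else 0 :=
  orthonormal_iff_ite.1 b.orthonormal i j

theorem perturbedDiagGraph_single_valued :
    ∀ p ∈ perturbedDiagGraph b d V, p.1 = 0 → p.2 = 0 := by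
  rintro ⟨f, g⟩ hp h0
  simp only at h0 ⊢
  subst h0
  apply eq_of_inner_basis_eq b
  intro j
  simpa using hp j

theorem basis_mem_perturbedDiagGraph (j : ι) :
    (b j, (d j : ℂ) • b j + V (b j)) ∈ perturbedDiagGraph b d V := by
  classical
  intro i
  simp only [inner_add_right, inner_smul_right, inner_basis_eq_ite]
  split_ifs with h
  · rw [h]
  · simp

theorem isClosed_perturbedDiagGraph :
    IsClosed (perturbedDiagGraph b d V : Set (E × E)) := by
  have : (perturbedDiagGraph b d V : Set (E × E)) =
      ⋂ j, {p | ⟪b j, p.2⟫_ℂ = d j * ⟪b j, p.1⟫_ℂ + ⟪b j, V p.1⟫_ℂ} := by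
    ext p
    simp only [SetLike.mem_coe, Set.mem_iInter, Set.mem_ofPred_eq]
    exact Iff.rfl
  rw [this]
  exact isClosed_iInter fun j => isClosed_eq (by fun_prop) (by fun_prop)

/-- The finite linear combinations of the basis vectors are a core. -/
theorem perturbedDiagGraph_le_closure {S : Submodule ℂ (E × E)}
    (hS : ∀ j, (b j, (d j : ℂ) • b j + V (b j)) ∈ S) :
    perturbedDiagGraph b d V ≤ S.topologicalClosure := by
  rintro ⟨f, g⟩ hp
  have h1 : HasSum (fun j => b.repr f j • b j) f := b.hasSum_repr f
  -- The vector to expand is `g - V f`, whose coefficients are `d j` times those of `f`; so the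
  -- partial sums of `f` and their images converge together.
  have h2 : HasSum (fun j => b.repr f j • ((d j : ℂ) • b j + V (b j))) g := by
    have h3 := b.hasSum_repr (g - V f)
    have h4 := (V.hasSum h1).add h3
    rw [add_sub_cancel] at h4
    refine h4.congr_fun ?_
    intro j
    have : b.repr (g - V f) j = d j * b.repr f j := by
      rw [b.repr_apply_apply, b.repr_apply_apply, inner_sub_right, hp j, add_sub_cancel_right]
    rw [this, map_smul, smul_add, smul_smul, mul_comm, add_comm]
  refine mem_closure_of_tendsto (h1.prodMk h2) (Filter.Eventually.of_forall fun s => ?_)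
  exact sum_mem fun j _ => S.smul_mem (b.repr f j) (hS j)

/-- Testing an adjoint pair on the basis vectors alone already forces the coefficient equations.
Conversely, by Parseval both sides of `key` are the same series, because the entries `d j` are real.
-/
theorem adjoint_perturbedDiagGraph (hV : ∀ x y, ⟪V x, y⟫_ℂ = ⟪x, V y⟫_ℂ) :
    (perturbedDiagGraph b d V).adjoint = perturbedDiagGraph b d V := by
  ext ⟨f, g⟩
  rw [Submodule.mem_adjoint_iff]
  constructor
  · intro h j
    have := h _ _ (basis_mem_perturbedDiagGraph j)
    simp only [inner_add_left, inner_smul_left, Complex.conj_ofReal, hV] at this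
    exact (sub_eq_zero.1 this).symm
  · intro h x y hxy
    have key : ⟪y - V x, f⟫_ℂ = ⟪x, g - V f⟫_ℂ := by
      refine (b.hasSum_inner_mul_inner _ _).unique ?_
      refine (b.hasSum_inner_mul_inner x (g - V f)).congr_fun ?_
      intro j
      rw [inner_sub_right, h j, ← inner_conj_symm (y - V x), inner_sub_right, hxy j,
        add_sub_cancel_right, add_sub_cancel_right, map_mul, Complex.conj_ofReal, inner_conj_symm]
      ring
    rw [inner_sub_left, inner_sub_right, hV] at key
    linear_combination key

/-- The graph of `T` is squeezed between a core of `D + V` and the closed graph of `D + V`, so no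
description of the domain of `T` is needed. -/
theorem closure_graph_eq {T : E →ₗ.[ℂ] E}
    (hS : ∀ j, (b j, (d j : ℂ) • b j + V (b j)) ∈ T.graph)
    (hT : T.graph ≤ perturbedDiagGraph b d V) :
    T.IsClosable ∧ T.closure.graph = perturbedDiagGraph b d V := by
  have h1 : T.graph.topologicalClosure = perturbedDiagGraph b d V :=
    le_antisymm (Submodule.topologicalClosure_minimal _ hT isClosed_perturbedDiagGraph)
      (perturbedDiagGraph_le_closure hS)
  have h2 : T.IsClosable := ⟨(perturbedDiagGraph b d V).toLinearPMap, by
    rw [h1, Submodule.toLinearPMap_graph_eq _ perturbedDiagGraph_single_valued]⟩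
  exact ⟨h2, by rw [← h2.graph_closure_eq_closure_graph, h1]⟩

theorem isSelfAdjoint_of_graph_eq [CompleteSpace E] {T : E →ₗ.[ℂ] E} (hT : T.graph = perturbedDiagGraph b d V)
    (hV : ∀ x y, ⟪V x, y⟫_ℂ = ⟪x, V y⟫_ℂ) : IsSelfAdjoint T := by
  -- The adjoint of a `LinearPMap` is meaningful only for a dense domain; here the domain contains
  -- the basis.
  have hd : Dense (T.domain : Set E) := by
    have : (T.domain).topologicalClosure = ⊤ := by
      rw [eq_top_iff, ← b.dense_span]
      refine Submodule.topologicalClosure_mono (Submodule.span_le.2 ?_)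
      rintro _ ⟨j, rfl⟩
      refine LinearPMap.mem_domain_of_mem_graph (y := (d j : ℂ) • b j + V (b j)) ?_
      rw [hT]
      exact basis_mem_perturbedDiagGraph j
    exact (Submodule.dense_iff_topologicalClosure_eq_top).2 this
  rw [LinearPMap.isSelfAdjoint_def]
  apply LinearPMap.eq_of_eq_graph
  rw [LinearPMap.adjoint_graph_eq_graph_adjoint hd, hT, adjoint_perturbedDiagGraph hV]

/-- The operator `D + V` is given by its matrix in the basis `b`. -/
theorem mem_perturbedDiagGraph_iff_hasSum {M : Matrix ι ι ℝ}
    (hM : ∀ i j, (M i j : ℂ) = ⟪b i, (d j : ℂ) • b j + V (b j)⟫_ℂ) {f g : E} :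
    (f, g) ∈ perturbedDiagGraph b d V ↔
      ∀ i, HasSum (fun j => (M i j : ℂ) * b.repr f j) (b.repr g i) := by
  classical
  -- No domain condition on `f` is needed: `D` contributes a single term to each row and `V` is
  -- continuous. Membership in the graph is therefore only a statement about the values of the sums.
  have h : ∀ i, HasSum (fun j => (M i j : ℂ) * b.repr f j) (d i * ⟪b i, f⟫_ℂ + ⟪b i, V f⟫_ℂ) := by
    intro i
    have h1 : HasSum (fun j => ⟪b i, V (b.repr f j • b j)⟫_ℂ) ⟪b i, V f⟫_ℂ :=
      (innerSL ℂ (b i)).hasSum (V.hasSum (b.hasSum_repr f))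
    have h2 : HasSum (fun j => if j = i then (d i : ℂ) * ⟪b i, f⟫_ℂ else 0)
      (d i * ⟪b i, f⟫_ℂ) := hasSum_ite_eq i _
    refine (h2.add h1).congr_fun ?_
    intro j
    rw [hM, inner_add_right, inner_smul_right, inner_basis_eq_ite, map_smul,
      inner_smul_right]
    by_cases hij : i = j
    · subst hij
      simp only [if_true, b.repr_apply_apply]
      ring
    · rw [if_neg hij, if_neg (Ne.symm hij)]
      ring
  rw [mem_perturbedDiagGraph]
  refine forall_congr' fun i => ?_
  rw [b.repr_apply_apply]
  exact ⟨fun hi => hi ▸ h i, fun hi => hi.unique (h i)⟩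

/-! ### Spectrum -/

/-- In terms of graphs no proofs of domain membership have to be carried, and graphs are what is
known about the closures. -/
theorem notMem_spectrumOf_iff {F : Type*} [NormedAddCommGroup F] [NormedSpace ℂ F]
    {A : F →ₗ.[ℂ] F} {z : ℂ} :
    z ∉ spectrumOf A ↔ ∃ R : F →L[ℂ] F, (∀ y, (R y, y + z • R y) ∈ A.graph) ∧
      ∀ x y, (x, y) ∈ A.graph → R (y - z • x) = x := by
  rw [spectrumOf, Set.notMem_compl_iff, Set.mem_ofPred_eq]
  refine exists_congr fun R => and_congr (forall_congr' fun y => ?_) ?_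
  · rw [LinearPMap.mem_graph_iff]
    constructor
    · rintro ⟨h, hy⟩
      exact ⟨⟨R y, h⟩, rfl, sub_eq_iff_eq_add.1 hy⟩
    · rintro ⟨⟨x, hx⟩, h1, h2⟩
      simp only at h1 h2
      subst h1
      exact ⟨hx, by rw [h2, add_sub_cancel_right]⟩
  · constructor
    · rintro h x y hxy
      obtain ⟨w, rfl, rfl⟩ := (LinearPMap.mem_graph_iff _).1 hxy
      exact h w
    · exact fun h x => h x (A x) (A.mem_graph x)

theorem spectrumOf_eq_of_equiv {F F' : Type*} [NormedAddCommGroup F] [NormedSpace ℂ F]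
    [NormedAddCommGroup F'] [NormedSpace ℂ F'] {A : F →ₗ.[ℂ] F} {B : F' →ₗ.[ℂ] F'}
    (U : F ≃L[ℂ] F') (h : ∀ f g, (f, g) ∈ A.graph ↔ (U f, U g) ∈ B.graph) :
    spectrumOf A = spectrumOf B := by
  have aux : ∀ z, z ∉ spectrumOf A ↔ z ∉ spectrumOf B := by
    intro z
    rw [notMem_spectrumOf_iff, notMem_spectrumOf_iff]
    constructor
    · rintro ⟨R, h1, h2⟩
      refine ⟨(U : F →L[ℂ] F') ∘L R ∘L (U.symm : F' →L[ℂ] F), fun y => ?_, fun x y hxy => ?_⟩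
      · simpa using (h _ _).1 (h1 (U.symm y))
      · have := h2 (U.symm x) (U.symm y) ((h _ _).2 (by simpa using hxy))
        simpa using congrArg U this
    · rintro ⟨R, h1, h2⟩
      refine ⟨(U.symm : F' →L[ℂ] F) ∘L R ∘L (U : F →L[ℂ] F'), fun y => ?_, fun x y hxy => ?_⟩
      · refine (h _ _).2 ?_
        simpa using h1 (U y)
      · have := h2 (U x) (U y) ((h _ _).1 hxy)
        simpa using congrArg U.symm this
  ext z
  exact not_iff_not.1 (aux z)

theorem isCompactOperator_rankOne (x y : E) : IsCompactOperator (InnerProductSpace.rankOne ℂ x y) := by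
  rw [InnerProductSpace.rankOne_def]
  have h : IsCompactOperator (innerSL ℂ y) :=
    isCompactOperator_of_locallyCompactSpace_dom (innerSL ℂ y)
  exact h.clm_comp ((ContinuousLinearMap.id ℂ ℂ).smulRight x)

/-- A diagonal operator with summable entries is compact. -/
theorem exists_compact_diagonal [CompleteSpace E] (b : HilbertBasis ι ℂ E) {κ : ι → ℝ} (hκ : Summable κ) :
    ∃ K : E →L[ℂ] E, IsCompactOperator K ∧ ∀ i y, ⟪b i, K y⟫_ℂ = κ i * ⟪b i, y⟫_ℂ := by
  classical
  -- The rank-one projections have norm one, so the series converges in operator norm and its limit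
  -- inherits compactness from the finite-rank partial sums.
  have hs : Summable fun j => (κ j : ℂ) • InnerProductSpace.rankOne ℂ (b j) (b j) := by
    refine Summable.of_norm ?_
    simpa [norm_smul, b.orthonormal.1] using hκ.abs
  obtain ⟨K, hK⟩ := hs
  refine ⟨K, ?_, fun i y => ?_⟩
  · refine isCompactOperator_of_tendsto hK (Filter.Eventually.of_forall fun s => ?_)
    induction s using Finset.induction_on with
    | empty => simpa using isCompactOperator_zero
    | insert j s hj ih =>
      rw [Finset.sum_insert hj]
      exact ((isCompactOperator_rankOne (b j) (b j)).smul (κ j : ℂ)).add ih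
  · have h1 : HasSum (fun j => (κ j : ℂ) • (⟪b j, y⟫_ℂ • b j)) (K y) := by
      simpa using (ContinuousLinearMap.apply ℂ E y).hasSum hK
    have h2 := (innerSL ℂ (b i)).hasSum h1
    have h3 : HasSum (fun j => if j = i then (κ i : ℂ) * ⟪b i, y⟫_ℂ else 0)
      (κ i * ⟪b i, y⟫_ℂ) := hasSum_ite_eq i _
    refine h2.unique (h3.congr_fun ?_)
    intro j
    simp only [innerSL_apply_apply, inner_smul_right,
      inner_basis_eq_ite]
    by_cases hij : i = j
    · subst hij
      simp
    · rw [if_neg hij, if_neg (Ne.symm hij)]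
      simp

/-- If the resolvent of `D` has summable entries, then the spectrum of `D + V` consists of
eigenvalues. -/
theorem mem_spectrumOf_iff_eigenvalue [CompleteSpace E] {T : E →ₗ.[ℂ] E} (hT : T.graph = perturbedDiagGraph b d V)
    {μ : ℝ} (hμ : ∀ j, d j ≠ μ) (hs : Summable fun j => (d j - μ)⁻¹) (z : ℂ) :
    z ∈ spectrumOf T ↔ ∃ x, x ≠ 0 ∧ (x, z • x) ∈ T.graph := by
  constructor
  · contrapose!
    intro h
    obtain ⟨K, hK, hKi⟩ := exists_compact_diagonal b hs
    have hdμ : ∀ j, (d j : ℂ) - μ ≠ 0 := fun j => by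
      rw [sub_ne_zero]
      exact_mod_cast hμ j
    -- With this `W`, `T - z = (D - μ) + W`; applying `K = (D - μ)⁻¹` removes the unbounded part.
    set W : E →L[ℂ] E := V + ((μ : ℂ) - z) • ContinuousLinearMap.id ℂ E with hW
    have solve : ∀ x y, (x, y + z • x) ∈ T.graph ↔ x + K (W x) = K y := by
      intro x y
      rw [hT, mem_perturbedDiagGraph]
      have : x + K (W x) = K y ↔ ∀ j, ⟪b j, x + K (W x)⟫_ℂ = ⟪b j, K y⟫_ℂ :=
        ⟨fun h j => by rw [h], eq_of_inner_basis_eq b⟩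
      rw [this]
      refine forall_congr' fun j => ?_
      rw [inner_add_right, inner_add_right, hKi, hKi, inner_smul_right]
      simp only [hW, add_apply, smul_apply,
        ContinuousLinearMap.id_apply, inner_add_right, inner_smul_right]
      push_cast
      have := hdμ j
      constructor
      · intro h
        field_simp
        linear_combination -h
      · intro h
        field_simp at h
        linear_combination -h
    have hc : IsCompactOperator (K ∘L W) := hK.comp_clm W
    -- Fredholm alternative for the compact operator `K W`: an eigenvector for `-1` would be an
    -- eigenvector of `T` for `z`, which `h` excludes.
    have hres : (-1 : ℂ) ∈ resolventSet ℂ (K ∘L W) := by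
      refine (hc.hasEigenvalue_or_mem_resolventSet (neg_ne_zero.2 one_ne_zero)).resolve_left ?_
      intro he
      obtain ⟨x, hx, hx0⟩ := he.exists_hasEigenvector
      rw [Module.End.mem_eigenspace_iff] at hx
      refine h x hx0 ?_
      have h1 := (solve x 0).2 (by
        have : K (W x) = (-1 : ℂ) • x := hx
        rw [this]
        simp)
      simpa using h1
    rw [spectrum.mem_resolventSet_iff] at hres
    obtain ⟨u, hu⟩ := hres
    have hu' : ∀ x, (u : E →L[ℂ] E) x = -(x + K (W x)) := by
      intro x
      rw [hu]
      simp [Algebra.algebraMap_eq_smul_one, sub_eq_add_neg, add_comm]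
    have hi1 : ∀ x, (u : E →L[ℂ] E) ((↑u⁻¹ : E →L[ℂ] E) x) = x := fun x => by
      rw [← mul_apply_eq_comp, u.mul_inv, one_apply_eq_self]
    have hi2 : ∀ x, (↑u⁻¹ : E →L[ℂ] E) ((u : E →L[ℂ] E) x) = x := fun x => by
      rw [← mul_apply_eq_comp, u.inv_mul, one_apply_eq_self]
    rw [notMem_spectrumOf_iff]
    -- Since `u = -(1 + K W)`, the resolvent `(1 + K W)⁻¹ K` is `-u⁻¹ K`.
    refine ⟨-((↑u⁻¹ : E →L[ℂ] E) ∘L K), fun y => ?_, fun x y hxy => ?_⟩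
    · rw [solve]
      have := hi1 (K y)
      rw [hu'] at this
      simpa [add_comm] using this
    · have h1 := (solve x (y - z • x)).1 (by rwa [sub_add_cancel])
      have h2 := hi2 x
      rw [hu', h1, map_neg] at h2
      simpa using h2
  · rintro ⟨x, hx, h⟩
    by_contra hz
    obtain ⟨R, -, h2⟩ := notMem_spectrumOf_iff.1 hz
    have := h2 _ _ h
    rw [sub_self, map_zero] at this
    exact hx this.symm

end DiagonalPerturbation

/-! ### Three-term recurrence of the Jacobi polynomials in homogeneous form. -/

section Jacobi

open Finset

/-- The coefficients of a Jacobi polynomial, up to a common factor, in the basis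
`((x - 1) / 2) ^ s * ((x + 1) / 2) ^ t`. -/
def jacobiCoeff (a b s t : ℕ) : ℝ :=
  1 / ((s.factorial : ℝ) * (a + s).factorial * t.factorial * (b + t).factorial)

/-- The sum of the terms `φ s t * X ^ s * Y ^ t` weighted by the Jacobi coefficients. -/
def jacobiSum (a b : ℕ) (X Y : ℝ) (φ : ℕ → ℕ → ℝ) (n : ℕ) : ℝ :=
  ∑ p ∈ antidiagonal n, jacobiCoeff a b p.1 p.2 * φ p.1 p.2 * X ^ p.1 * Y ^ p.2

/-- The Jacobi polynomial divided by `(n + a)! (n + b)!`, as a homogeneous polynomial in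
`X = (x - 1) / 2` and `Y = (x + 1) / 2`. -/
def jacobiHom (a b : ℕ) (X Y : ℝ) (n : ℕ) : ℝ :=
  jacobiSum a b X Y (fun _ _ => 1) n

variable {a b : ℕ} {X Y : ℝ}

theorem jacobiCoeff_succ_left (s t : ℕ) :
    jacobiCoeff a b (s + 1) t * (((s + 1 : ℕ) : ℝ) * (a + (s + 1 : ℕ))) = jacobiCoeff a b s t := by
  have h1 : (s.factorial : ℝ) ≠ 0 := by positivity
  have h2 : ((a + s).factorial : ℝ) ≠ 0 := by positivity
  have h3 : (t.factorial : ℝ) ≠ 0 := by positivity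
  have h4 : ((b + t).factorial : ℝ) ≠ 0 := by positivity
  have h5 : (s : ℝ) + 1 ≠ 0 := by positivity
  have h6 : (a : ℝ) + s + 1 ≠ 0 := by positivity
  rw [jacobiCoeff, jacobiCoeff, ← add_assoc, Nat.factorial_succ, Nat.factorial_succ]
  push_cast
  field_simp
  ring

theorem jacobiCoeff_succ_right (s t : ℕ) :
    jacobiCoeff a b s (t + 1) * (((t + 1 : ℕ) : ℝ) * (b + (t + 1 : ℕ))) = jacobiCoeff a b s t := by
  have h1 : (s.factorial : ℝ) ≠ 0 := by positivity
  have h2 : ((a + s).factorial : ℝ) ≠ 0 := by positivity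
  have h3 : (t.factorial : ℝ) ≠ 0 := by positivity
  have h4 : ((b + t).factorial : ℝ) ≠ 0 := by positivity
  have h5 : (t : ℝ) + 1 ≠ 0 := by positivity
  have h6 : (b : ℝ) + t + 1 ≠ 0 := by positivity
  rw [jacobiCoeff, jacobiCoeff, ← add_assoc, Nat.factorial_succ, Nat.factorial_succ]
  push_cast
  field_simp
  ring

/-- Multiplication by `X` is an index shift, and `jacobiCoeff` is normalised so that the shift costs
exactly the weight `s (a + s)`; the new boundary term `s = 0` has weight zero. Identities between
products thus reduce to polynomial identities in `s` and `t` on one antidiagonal. -/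
theorem mul_left_jacobiSum (φ : ℕ → ℕ → ℝ) (n : ℕ) :
    jacobiSum a b X Y (fun s t => s * (a + s) * φ s t) (n + 1) =
      X * jacobiSum a b X Y (fun s t => φ (s + 1) t) n := by
  rw [jacobiSum, Nat.sum_antidiagonal_succ, jacobiSum, mul_sum]
  simp only [Nat.cast_zero, zero_mul, mul_zero, zero_add]
  refine sum_congr rfl fun p _ => ?_
  rw [← jacobiCoeff_succ_left p.1 p.2]
  ring

theorem mul_right_jacobiSum (φ : ℕ → ℕ → ℝ) (n : ℕ) :
    jacobiSum a b X Y (fun s t => t * (b + t) * φ s t) (n + 1) =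
      Y * jacobiSum a b X Y (fun s t => φ s (t + 1)) n := by
  rw [jacobiSum, Nat.sum_antidiagonal_succ', jacobiSum, mul_sum]
  simp only [Nat.cast_zero, zero_mul, mul_zero, zero_add]
  refine sum_congr rfl fun p _ => ?_
  rw [← jacobiCoeff_succ_right p.1 p.2]
  ring

theorem left_mul_jacobiHom (n : ℕ) :
    X * jacobiHom a b X Y n = jacobiSum a b X Y (fun s _ => s * (a + s)) (n + 1) := by
  simpa [jacobiHom] using (mul_left_jacobiSum (a := a) (b := b) (X := X) (Y := Y) (fun _ _ => 1) n).symm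

theorem right_mul_jacobiHom (n : ℕ) :
    Y * jacobiHom a b X Y n = jacobiSum a b X Y (fun _ t => t * (b + t)) (n + 1) := by
  simpa [jacobiHom] using (mul_right_jacobiSum (a := a) (b := b) (X := X) (Y := Y) (fun _ _ => 1) n).symm

theorem left_sq_mul_jacobiHom (n : ℕ) :
    X ^ 2 * jacobiHom a b X Y n =
      jacobiSum a b X Y (fun s _ => s * (a + s) * ((s - 1) * (a + s - 1))) (n + 2) := by
  rw [pow_two, mul_assoc, left_mul_jacobiHom, mul_left_jacobiSum]
  congr 2
  funext s t
  push_cast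
  ring

theorem right_sq_mul_jacobiHom (n : ℕ) :
    Y ^ 2 * jacobiHom a b X Y n =
      jacobiSum a b X Y (fun _ t => t * (b + t) * ((t - 1) * (b + t - 1))) (n + 2) := by
  rw [pow_two, mul_assoc, right_mul_jacobiHom, mul_right_jacobiSum]
  congr 2
  funext s t
  push_cast
  ring

theorem left_mul_right_mul_jacobiHom (n : ℕ) :
    X * (Y * jacobiHom a b X Y n) =
      jacobiSum a b X Y (fun s t => s * (a + s) * (t * (b + t))) (n + 2) := by
  rw [right_mul_jacobiHom, mul_left_jacobiSum]

/-- The three-term recurrence of the Jacobi polynomials, in homogeneous form. -/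
theorem jacobiHom_recurrence_hom (n : ℕ) :
    2 * (n + 2) * (n + a + b + 2) * (2 * n + a + b + 2) * (n + 2 + a) * (n + 2 + b)
        * jacobiHom a b X Y (n + 2) =
      (2 * n + a + b + 3) * ((2 * n + a + b + 4) * (2 * n + a + b + 2) * (X + Y)
        + ((a : ℝ) ^ 2 - b ^ 2) * (Y - X)) * jacobiHom a b X Y (n + 1)
      - 2 * (2 * n + a + b + 4) * (Y - X) ^ 2 * jacobiHom a b X Y n := by
  have e1 : ((2 * n + a + b + 3 : ℝ) * ((2 * n + a + b + 4) * (2 * n + a + b + 2) * (X + Y)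
        + ((a : ℝ) ^ 2 - b ^ 2) * (Y - X)) * jacobiHom a b X Y (n + 1)
      - 2 * (2 * n + a + b + 4) * (Y - X) ^ 2 * jacobiHom a b X Y n) =
      (2 * n + a + b + 3) * (((2 * n + a + b + 4) * (2 * n + a + b + 2) - ((a : ℝ) ^ 2 - b ^ 2))
        * (X * jacobiHom a b X Y (n + 1))
        + ((2 * n + a + b + 4) * (2 * n + a + b + 2) + ((a : ℝ) ^ 2 - b ^ 2))
        * (Y * jacobiHom a b X Y (n + 1)))
      - 2 * (2 * n + a + b + 4) * (X ^ 2 * jacobiHom a b X Y n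
        - 2 * (X * (Y * jacobiHom a b X Y n)) + Y ^ 2 * jacobiHom a b X Y n) := by
    ring
  rw [e1, left_mul_jacobiHom, right_mul_jacobiHom, left_sq_mul_jacobiHom, right_sq_mul_jacobiHom,
    left_mul_right_mul_jacobiHom, jacobiHom]
  simp only [jacobiSum, mul_sum, ← sum_add_distrib, ← sum_sub_distrib]
  refine sum_congr rfl fun p hp => ?_
  -- The powers of `Y - X`, equal to one in the application, make all terms homogeneous of degree `n
  -- + 2`; with `n = s + t - 2` the weights then agree as polynomials in `s`, `t`.
  have hn : (n : ℝ) = p.1 + p.2 - 2 := by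
    rw [eq_sub_iff_add_eq]
    exact_mod_cast (mem_antidiagonal.1 hp).symm
  rw [hn]
  ring

theorem jacobiHom_recurrence (n : ℕ) (hXY : Y - X = 1) :
    (X + Y) * jacobiHom a b X Y (n + 1) =
      2 * ((n + 2) * (n + 2 + a) * (n + 2 + b) * (n + 2 + a + b))
          / ((2 * n + a + b + 3) * (2 * n + a + b + 4)) * jacobiHom a b X Y (n + 2)
        + ((b : ℝ) ^ 2 - a ^ 2) / ((2 * n + a + b + 2) * (2 * n + a + b + 4))
          * jacobiHom a b X Y (n + 1)
        + 2 / ((2 * n + a + b + 3) * (2 * n + a + b + 2)) * jacobiHom a b X Y n := by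
  have h := jacobiHom_recurrence_hom (a := a) (b := b) (X := X) (Y := Y) n
  rw [hXY] at h
  have h2 : (2 * n + a + b + 2 : ℝ) ≠ 0 := by positivity
  have h3 : (2 * n + a + b + 3 : ℝ) ≠ 0 := by positivity
  have h4 : (2 * n + a + b + 4 : ℝ) ≠ 0 := by positivity
  field_simp
  linear_combination -h

/-- The bottom case is separate: there is no lower neighbour, and the general diagonal coefficient
has to be cancelled by `a + b`, which may be zero. -/
theorem jacobiHom_recurrence_zero (hXY : Y - X = 1) :
    (X + Y) * jacobiHom a b X Y 0 =
      2 * ((1 + a) * (1 + b)) / (a + b + 2) * jacobiHom a b X Y 1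
        + ((b : ℝ) - a) / (a + b + 2) * jacobiHom a b X Y 0 := by
  have h1 := left_mul_jacobiHom (a := a) (b := b) (X := X) (Y := Y) 0
  have h2 := right_mul_jacobiHom (a := a) (b := b) (X := X) (Y := Y) 0
  have h3 : (a + b + 2 : ℝ) ≠ 0 := by positivity
  have h4 : jacobiHom a b X Y 1 * ((1 + a) * (1 + b)) =
      (1 + b) * (X * jacobiHom a b X Y 0) + (1 + a) * (Y * jacobiHom a b X Y 0) := by
    rw [h1, h2, jacobiHom]
    simp only [jacobiSum, mul_sum, sum_mul, ← sum_add_distrib]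
    refine sum_congr rfl fun p hp => ?_
    have hp' := mem_antidiagonal.1 hp
    have : p = (0, 1) ∨ p = (1, 0) := by
      rcases p with ⟨s, t⟩
      simp only [Prod.mk.injEq] at hp' ⊢
      omega
    rcases this with rfl | rfl <;> simp <;> ring
  field_simp
  linear_combination -2 * h4 + (b - a : ℝ) * jacobiHom a b X Y 0 * hXY

theorem jacobiP_eq (n a b : ℕ) (x : ℝ) :
    jacobiP n a b x =
      (n + a).factorial * (n + b).factorial * jacobiHom a b ((x - 1) / 2) ((x + 1) / 2) n := by
  rw [jacobiP, jacobiHom, jacobiSum, mul_sum,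
    ← Nat.sum_antidiagonal_eq_sum_range_succ (fun s t => ((n + a).choose t : ℝ)
      * ((n + b).choose s : ℝ) * ((x - 1) / 2) ^ s * ((x + 1) / 2) ^ t) n]
  refine sum_congr rfl fun p hp => ?_
  obtain ⟨s, t⟩ := p
  obtain rfl : s + t = n := mem_antidiagonal.1 hp
  have e1 : s + t + a = t + (a + s) := by ring
  have e2 : s + t + b = s + (b + t) := by ring
  simp only [e1, e2, Nat.cast_add_choose, jacobiCoeff]
  field_simp

end Jacobi

/-! ### The Wigner functions: eigenvalue equation, normalisation and recurrence. -/

section Wigner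

open Finset

/-! ### Powers of the half-angle functions -/

/-- The monomial `sin(θ/2)^A cos(θ/2)^B`. -/
def halfPow (A B : ℕ) (θ : ℝ) : ℝ := Real.sin (θ / 2) ^ A * Real.cos (θ / 2) ^ B

/-- The derivative of `halfPow A B`. -/
def halfPowDeriv (A B : ℕ) (θ : ℝ) : ℝ :=
  A / 2 * Real.sin (θ / 2) ^ (A - 1) * Real.cos (θ / 2) ^ (B + 1)
    - B / 2 * Real.sin (θ / 2) ^ (A + 1) * Real.cos (θ / 2) ^ (B - 1)

theorem hasDerivAt_halfPow (A B : ℕ) (θ : ℝ) : HasDerivAt (halfPow A B) (halfPowDeriv A B θ) θ := by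
  have h0 : HasDerivAt (fun t : ℝ => t / 2) (1 / 2) θ := (hasDerivAt_id θ).div_const 2
  have h1 := (h0.sin.pow A).mul (h0.cos.pow B)
  refine h1.congr_deriv ?_
  rw [halfPowDeriv]
  simp only [Pi.pow_apply]
  ring

theorem sin_eq_half (θ : ℝ) : Real.sin θ = 2 * Real.sin (θ / 2) * Real.cos (θ / 2) := by
  rw [← Real.sin_two_mul]
  congr 1
  ring

theorem cos_eq_half (θ : ℝ) : Real.cos θ = Real.cos (θ / 2) ^ 2 - Real.sin (θ / 2) ^ 2 := by
  rw [← Real.cos_two_mul']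
  congr 1
  ring

/-- The operator `sin θ d/dθ` sends monomials to monomials without lowering an exponent, so it can
be iterated with no singular terms. -/
theorem sin_mul_halfPowDeriv (A B : ℕ) (θ : ℝ) :
    Real.sin θ * halfPowDeriv A B θ = A * halfPow A (B + 2) θ - B * halfPow (A + 2) B θ := by
  rw [sin_eq_half, halfPowDeriv, halfPow, halfPow]
  -- The exponents `A - 1`, `B - 1` are truncated at zero, where their coefficients vanish.
  rcases A with _ | A <;> rcases B with _ | B <;> simp <;> ring

/-- The derivative of `θ ↦ sin θ * halfPowDeriv A B θ`. -/
theorem hasDerivAt_sin_mul_halfPowDeriv (A B : ℕ) (θ : ℝ) :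
    HasDerivAt (fun t => Real.sin t * halfPowDeriv A B t)
      (A * halfPowDeriv A (B + 2) θ - B * halfPowDeriv (A + 2) B θ) θ := by
  simp only [sin_mul_halfPowDeriv]
  exact ((hasDerivAt_halfPow _ _ θ).const_mul _).sub ((hasDerivAt_halfPow _ _ θ).const_mul _)

theorem contDiff_halfPow (A B : ℕ) : ContDiff ℝ 2 (halfPow A B) := by
  unfold halfPow
  fun_prop

/-! ### The eigenvalue equation -/

theorem lSqReduced_ofReal {m k : ℤ} {f f' : ℝ → ℝ} {g θ : ℝ} (hf : ∀ t, HasDerivAt f (f' t) t)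
    (hg : HasDerivAt (fun t => Real.sin t * f' t) g θ) :
    lSqReduced m k (fun t => (f t : ℂ)) θ =
      ((-(1 / Real.sin θ) * g
        + ((m : ℝ) ^ 2 + (k : ℝ) ^ 2 - 2 * m * k * Real.cos θ) / Real.sin θ ^ 2 * f θ : ℝ) : ℂ) := by
  have h1 : deriv (fun t => (f t : ℂ)) = fun t => ((f' t : ℝ) : ℂ) :=
    funext fun t => (hf t).ofReal_comp.deriv
  have h2 : (fun t => (Real.sin t : ℂ) * ((f' t : ℝ) : ℂ)) =
      fun t => ((Real.sin t * f' t : ℝ) : ℂ) := by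
    funext t
    push_cast
    rfl
  rw [lSqReduced, h1, h2, hg.ofReal_comp.deriv]
  push_cast
  rfl

/-- The unnormalised `θ`-factor of a Wigner function. -/
def wignerCore (a b n : ℕ) (θ : ℝ) : ℝ :=
  Real.sin (θ / 2) ^ a * Real.cos (θ / 2) ^ b
    * jacobiHom a b (-Real.sin (θ / 2) ^ 2) (Real.cos (θ / 2) ^ 2) n

theorem wignerCore_eq_sum (a b n : ℕ) : wignerCore a b n = fun θ =>
    ∑ p ∈ antidiagonal n, jacobiCoeff a b p.1 p.2 * (-1) ^ p.1
      * halfPow (a + 2 * p.1) (b + 2 * p.2) θ := by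
  funext θ
  rw [wignerCore, jacobiHom, jacobiSum, mul_sum]
  refine sum_congr rfl fun p _ => ?_
  rw [halfPow, neg_pow, pow_add, pow_add, pow_mul, pow_mul]
  ring

theorem contDiff_wignerCore (a b n : ℕ) : ContDiff ℝ 2 (wignerCore a b n) := by
  rw [wignerCore_eq_sum]
  exact ContDiff.sum fun p _ => contDiff_const.mul (contDiff_halfPow _ _)

/-- For `n > 0` both sides are `X Y` times the polynomial of degree `n - 1`. This relation between
neighbouring coefficients plays the role of the Jacobi differential equation. -/
theorem right_mul_jacobiSum_left {a b : ℕ} {X Y : ℝ} (n : ℕ) :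
    Y * jacobiSum a b X Y (fun s _ => s * (a + s)) n =
      X * jacobiSum a b X Y (fun _ t => t * (b + t)) n := by
  rcases n with _ | n
  · simp [jacobiSum]
  · rw [← left_mul_jacobiHom, ← right_mul_jacobiHom]
    ring

/-- After multiplication by `sin² θ = -4 X Y` the operator acts monomial by monomial through `(sin θ
d/dθ)²`, and the claim becomes an identity between weighted sums over one antidiagonal. -/
theorem lSqReduced_wignerCore {m k : ℤ} {a b : ℕ} (ha : (a : ℝ) ^ 2 = ((m : ℝ) - k) ^ 2)
    (hb : (b : ℝ) ^ 2 = ((m : ℝ) + k) ^ 2) (n : ℕ) {θ : ℝ} (hθ : θ ∈ Set.Ioo 0 Real.pi) :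
    lSqReduced m k (fun t => (wignerCore a b n t : ℂ)) θ =
      (((n + (a + b) / 2) * (n + (a + b) / 2 + 1) * wignerCore a b n θ : ℝ) : ℂ) := by
  set c : ℕ × ℕ → ℝ := fun p => jacobiCoeff a b p.1 p.2 * (-1) ^ p.1 with hc
  have hf : ∀ t, HasDerivAt (wignerCore a b n)
      (∑ p ∈ antidiagonal n, c p * halfPowDeriv (a + 2 * p.1) (b + 2 * p.2) t) t := by
    intro t
    rw [wignerCore_eq_sum]
    exact HasDerivAt.fun_sum fun p _ => (hasDerivAt_halfPow _ _ t).const_mul _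
  have hg : HasDerivAt (fun t => Real.sin t *
      ∑ p ∈ antidiagonal n, c p * halfPowDeriv (a + 2 * p.1) (b + 2 * p.2) t)
      (∑ p ∈ antidiagonal n, c p * (((a + 2 * p.1 : ℕ) : ℝ)
          * halfPowDeriv (a + 2 * p.1) (b + 2 * p.2 + 2) θ
        - ((b + 2 * p.2 : ℕ) : ℝ) * halfPowDeriv (a + 2 * p.1 + 2) (b + 2 * p.2) θ)) θ := by
    have : (fun t => Real.sin t *
        ∑ p ∈ antidiagonal n, c p * halfPowDeriv (a + 2 * p.1) (b + 2 * p.2) t) = fun t =>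
        ∑ p ∈ antidiagonal n, c p *
          (Real.sin t * halfPowDeriv (a + 2 * p.1) (b + 2 * p.2) t) := by
      funext t
      rw [mul_sum]
      exact sum_congr rfl fun p _ => by ring
    rw [this]
    exact HasDerivAt.fun_sum fun p _ => (hasDerivAt_sin_mul_halfPowDeriv _ _ θ).const_mul _
  rw [lSqReduced_ofReal hf hg]
  congr 1
  have hs : Real.sin θ ≠ 0 := (Real.sin_pos_of_pos_of_lt_pi hθ.1 hθ.2).ne'
  set X := -Real.sin (θ / 2) ^ 2 with hX
  set Y := Real.cos (θ / 2) ^ 2 with hY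
  set w := Real.sin (θ / 2) ^ a * Real.cos (θ / 2) ^ b with hw
  have hXY : Y - X = 1 := by
    rw [hX, hY]
    linarith [Real.sin_sq_add_cos_sq (θ / 2)]
  have hs2 : Real.sin θ ^ 2 = -4 * X * Y := by
    rw [sin_eq_half, hX, hY]
    ring
  have hcos : Real.cos θ = X + Y := by
    rw [cos_eq_half, hX, hY]
    ring
  have hsum : Real.sin θ * (∑ p ∈ antidiagonal n, c p * (((a + 2 * p.1 : ℕ) : ℝ)
          * halfPowDeriv (a + 2 * p.1) (b + 2 * p.2 + 2) θ
        - ((b + 2 * p.2 : ℕ) : ℝ) * halfPowDeriv (a + 2 * p.1 + 2) (b + 2 * p.2) θ)) =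
      w * jacobiSum a b X Y (fun s t => ((a : ℝ) + 2 * s) ^ 2 * Y ^ 2
        + (2 * ((a : ℝ) + 2 * s) * (b + 2 * t) + 2 * (a + 2 * s) + 2 * (b + 2 * t)) * (X * Y)
        + ((b : ℝ) + 2 * t) ^ 2 * X ^ 2) n := by
    rw [jacobiSum, mul_sum, mul_sum]
    refine sum_congr rfl fun p _ => ?_
    have e1 := sin_mul_halfPowDeriv (a + 2 * p.1) (b + 2 * p.2 + 2) θ
    have e2 := sin_mul_halfPowDeriv (a + 2 * p.1 + 2) (b + 2 * p.2) θ
    have e3 : ∀ i j : ℕ, halfPow (a + 2 * p.1 + 2 * i) (b + 2 * p.2 + 2 * j) θ =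
        w * ((-1) ^ p.1 * (-1) ^ i * (X ^ p.1 * X ^ i) * (Y ^ p.2 * Y ^ j)) := by
      intro i j
      rw [halfPow, hw, hX, hY, ← pow_add, ← pow_add, ← pow_add, ← neg_pow, neg_neg, ← pow_mul,
        ← pow_mul]
      ring
    have e4 : ((-1 : ℝ) ^ p.1) ^ 2 = 1 := by rw [← pow_mul, mul_comm, pow_mul]; simp
    have e02 := e3 0 2
    have e11 := e3 1 1
    have e20 := e3 2 0
    simp only [mul_zero, mul_one, add_zero] at e02 e11 e20
    have e5 : Real.sin θ * (c p * (((a + 2 * p.1 : ℕ) : ℝ)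
          * halfPowDeriv (a + 2 * p.1) (b + 2 * p.2 + 2) θ
        - ((b + 2 * p.2 : ℕ) : ℝ) * halfPowDeriv (a + 2 * p.1 + 2) (b + 2 * p.2) θ)) =
      c p * (((a + 2 * p.1 : ℕ) : ℝ)
          * (Real.sin θ * halfPowDeriv (a + 2 * p.1) (b + 2 * p.2 + 2) θ)
        - ((b + 2 * p.2 : ℕ) : ℝ) *
          (Real.sin θ * halfPowDeriv (a + 2 * p.1 + 2) (b + 2 * p.2) θ)) := by ring
    rw [e5, e1, e2, e11]
    have e02' : halfPow (a + 2 * p.1) (b + 2 * p.2 + 2 + 2) θ = _ := e02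
    have e20' : halfPow (a + 2 * p.1 + 2 + 2) (b + 2 * p.2) θ = _ := e20
    rw [e02', e20', hc]
    push_cast
    linear_combination (jacobiCoeff a b p.1 p.2 * w * X ^ p.1 * Y ^ p.2 *
      (((a : ℝ) + 2 * p.1) ^ 2 * Y ^ 2
        + (2 * ((a : ℝ) + 2 * p.1) * (b + 2 * p.2) + 2 * (a + 2 * p.1) + 2 * (b + 2 * p.2))
          * (X * Y)
        + ((b : ℝ) + 2 * p.2) ^ 2 * X ^ 2)) * e4
  -- Uses `(a + 2 s)² = a² + 4 s (a + s)`, its analogue for `t`, and `n = s + t`. The last two sums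
  -- combine to `4 (Y - X)` times the difference in `hcross`, hence to zero; the terms in `a²`, `b²`
  -- are `(Y - X)(a² Y - b² X)` and cancel the centrifugal potential.
  have hsplit : jacobiSum a b X Y (fun s t => ((a : ℝ) + 2 * s) ^ 2 * Y ^ 2
        + (2 * ((a : ℝ) + 2 * s) * (b + 2 * t) + 2 * (a + 2 * s) + 2 * (b + 2 * t)) * (X * Y)
        + ((b : ℝ) + 2 * t) ^ 2 * X ^ 2) n =
      (a ^ 2 * Y ^ 2 + b ^ 2 * X ^ 2 - (a ^ 2 + b ^ 2) * (X * Y)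
        + 4 * ((n + (a + b) / 2) * (n + (a + b) / 2 + 1)) * (X * Y)) * jacobiHom a b X Y n
      + 4 * (Y ^ 2 - X * Y) * jacobiSum a b X Y (fun s _ => s * (a + s)) n
      + 4 * (X ^ 2 - X * Y) * jacobiSum a b X Y (fun _ t => t * (b + t)) n := by
    rw [jacobiHom]
    simp only [jacobiSum, mul_sum, ← sum_add_distrib]
    refine sum_congr rfl fun p hp => ?_
    have hn : (n : ℝ) = p.1 + p.2 := by exact_mod_cast (mem_antidiagonal.1 hp).symm
    rw [hn]
    ring
  have hcross := right_mul_jacobiSum_left (a := a) (b := b) (X := X) (Y := Y) n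
  have hpot : (m : ℝ) ^ 2 + (k : ℝ) ^ 2 - 2 * m * k * Real.cos θ = a ^ 2 * Y - b ^ 2 * X := by
    rw [hcos, ha, hb]
    linear_combination -((m : ℝ) ^ 2 + (k : ℝ) ^ 2) * hXY
  have hcore : wignerCore a b n θ = w * jacobiHom a b X Y n := rfl
  refine mul_left_cancel₀ (pow_ne_zero 2 hs) ?_
  rw [mul_add, hpot, hcore]
  have e1 : ∀ g : ℝ, Real.sin θ ^ 2 * (-(1 / Real.sin θ) * g) = -(Real.sin θ * g) := by
    intro g
    field_simp
  have e2 : ∀ v u : ℝ, Real.sin θ ^ 2 * (v / Real.sin θ ^ 2 * u) = v * u := by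
    intro v u
    field_simp
  rw [e1, e2, hsum, hsplit, hs2]
  linear_combination (-4 * w * (Y - X)) * hcross
    - (a ^ 2 * Y - b ^ 2 * X) * w * jacobiHom a b X Y n * hXY

/-! ### Normalisation -/

/-- The square of the factor between `wignerTheta` and `wignerCore`. -/
def wignerNormSq (a b n : ℕ) : ℝ :=
  (2 * n + a + b + 1) / 2 * (n.factorial * (n + a + b).factorial * (n + a).factorial
    * (n + b).factorial)

/-- The squared off-diagonal entries of the Jacobi matrix of the Jacobi polynomials. -/
def jacobiOffDiagSq (a b n : ℕ) : ℝ :=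
  4 * ((n + 1) * (n + 1 + a) * (n + 1 + b) * (n + 1 + a + b))
    / ((2 * n + a + b + 1) * (2 * n + a + b + 2) ^ 2 * (2 * n + a + b + 3))

theorem wignerNormSq_succ (a b n : ℕ) :
    wignerNormSq a b (n + 1) * (2 * n + a + b + 1) =
      (2 * n + a + b + 3) * ((n + 1) * (n + 1 + a) * (n + 1 + b) * (n + 1 + a + b))
        * wignerNormSq a b n := by
  have e1 : n + 1 + a + b = (n + a + b) + 1 := by ring
  have e2 : n + 1 + a = (n + a) + 1 := by ring
  have e3 : n + 1 + b = (n + b) + 1 := by ring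
  rw [wignerNormSq, wignerNormSq, e1, e2, e3]
  simp only [Nat.factorial_succ]
  push_cast
  ring

theorem wignerNormSq_pos (a b n : ℕ) : 0 < wignerNormSq a b n := by
  unfold wignerNormSq
  positivity

theorem jacobiOffDiagSq_pos (a b n : ℕ) : 0 < jacobiOffDiagSq a b n := by
  unfold jacobiOffDiagSq
  positivity

theorem sqrt_mul_sqrt_eq {x y z c : ℝ} (hx : 0 ≤ x) (hc : 0 ≤ c) (h : x * y = c ^ 2 * z) :
    √x * √y = c * √z := by
  rw [← Real.sqrt_mul hx, h, Real.sqrt_mul (sq_nonneg c), Real.sqrt_sq hc]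

/-- Normalisation symmetrises the recurrence: the upper coefficient (here) and the lower one
(`sqrt_jacobiOffDiagSq_mul`) both turn into the same number `√(jacobiOffDiagSq a b n)`. -/
theorem sqrt_jacobiOffDiagSq_mul_succ (a b n : ℕ) :
    √(jacobiOffDiagSq a b n) * √(wignerNormSq a b (n + 1)) =
      2 * ((n + 1) * (n + 1 + a) * (n + 1 + b) * (n + 1 + a + b))
        / ((2 * n + a + b + 1) * (2 * n + a + b + 2)) * √(wignerNormSq a b n) := by
  refine sqrt_mul_sqrt_eq (jacobiOffDiagSq_pos a b n).le (by positivity) ?_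
  have h1 : (2 * n + a + b + 1 : ℝ) ≠ 0 := by positivity
  have h2 : (2 * n + a + b + 2 : ℝ) ≠ 0 := by positivity
  have h3 : (2 * n + a + b + 3 : ℝ) ≠ 0 := by positivity
  have h := wignerNormSq_succ a b n
  rw [← eq_div_iff h1] at h
  rw [h, jacobiOffDiagSq]
  field_simp
  ring

theorem sqrt_jacobiOffDiagSq_mul (a b n : ℕ) :
    √(jacobiOffDiagSq a b n) * √(wignerNormSq a b n) =
      2 / ((2 * n + a + b + 3) * (2 * n + a + b + 2)) * √(wignerNormSq a b (n + 1)) := by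
  refine sqrt_mul_sqrt_eq (jacobiOffDiagSq_pos a b n).le (by positivity) ?_
  have h1 : (2 * n + a + b + 1 : ℝ) ≠ 0 := by positivity
  have h2 : (2 * n + a + b + 2 : ℝ) ≠ 0 := by positivity
  have h3 : (2 * n + a + b + 3 : ℝ) ≠ 0 := by positivity
  have h := wignerNormSq_succ a b n
  rw [← eq_div_iff h1] at h
  rw [h, jacobiOffDiagSq]
  field_simp
  ring

/-- The lowest level `max(|m|, |k|)`. -/
def minLevel (m k : ℤ) : ℕ := max m.natAbs k.natAbs

theorem natAbs_sub_add_natAbs_add (m k : ℤ) :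
    (m - k).natAbs + (m + k).natAbs = 2 * minLevel m k := by
  unfold minLevel
  omega

theorem cast_minLevel (m k : ℤ) :
    (minLevel m k : ℝ) = (((m - k).natAbs : ℝ) + ((m + k).natAbs : ℝ)) / 2 := by
  rw [eq_div_iff two_ne_zero, mul_comm]
  exact_mod_cast (natAbs_sub_add_natAbs_add m k).symm

theorem sq_natAbs_sub (m k : ℤ) : ((m - k).natAbs : ℝ) ^ 2 = ((m : ℝ) - k) ^ 2 := by
  rw [Nat.cast_natAbs, Int.cast_abs, sq_abs]
  push_cast
  rfl

theorem sq_natAbs_add (m k : ℤ) : ((m + k).natAbs : ℝ) ^ 2 = ((m : ℝ) + k) ^ 2 := by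
  rw [Nat.cast_natAbs, Int.cast_abs, sq_abs]
  push_cast
  rfl

/-- Writing `j = n + minLevel m k` removes the truncated subtraction; the factor `(n + a)! (n + b)!`
of `jacobiP_eq` is absorbed into the norm. -/
theorem wignerTheta_add_minLevel (m k : ℤ) (n : ℕ) (θ : ℝ) :
    wignerTheta m k (n + minLevel m k) θ = (-1) ^ (n + minLevel m k) *
      (√(wignerNormSq (m - k).natAbs (m + k).natAbs n)
        * wignerCore (m - k).natAbs (m + k).natAbs n θ) := by
  have h0 : n + minLevel m k - max m.natAbs k.natAbs = n := by
    unfold minLevel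
    omega
  have hx : ((Real.cos θ - 1) / 2) = -Real.sin (θ / 2) ^ 2 := by
    rw [cos_eq_half]
    linear_combination (1 / 2) * Real.sin_sq_add_cos_sq (θ / 2)
  have hy : ((Real.cos θ + 1) / 2) = Real.cos (θ / 2) ^ 2 := by
    rw [cos_eq_half]
    linear_combination -(1 / 2) * Real.sin_sq_add_cos_sq (θ / 2)
  have hj : ((n + minLevel m k : ℕ) : ℝ) =
      n + (((m - k).natAbs : ℝ) + ((m + k).natAbs : ℝ)) / 2 := by
    rw [Nat.cast_add, cast_minLevel]
  simp only [wignerTheta]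
  rw [h0, jacobiP_eq, hx, hy, wignerCore, hj]
  generalize (m - k).natAbs = a
  generalize (m + k).natAbs = b
  have key : √((2 * ((n : ℝ) + (a + b) / 2) + 1) / 2 * (((n.factorial : ℝ)
      * ((n + a + b).factorial : ℝ)) / (((n + a).factorial : ℝ) * ((n + b).factorial : ℝ))))
      * ((n + a).factorial * (n + b).factorial) = √(wignerNormSq a b n) := by
    have h1 : ((n + a).factorial : ℝ) ≠ 0 := by positivity
    have h2 : ((n + b).factorial : ℝ) ≠ 0 := by positivity
    have h3 : wignerNormSq a b n = (2 * ((n : ℝ) + (a + b) / 2) + 1) / 2 * (((n.factorial : ℝ)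
        * ((n + a + b).factorial : ℝ)) / (((n + a).factorial : ℝ) * ((n + b).factorial : ℝ)))
        * ((n + a).factorial * (n + b).factorial) ^ 2 := by
      rw [wignerNormSq]
      field_simp
      ring
    rw [h3, Real.sqrt_mul' _ (sq_nonneg _), Real.sqrt_sq (by positivity)]
  rw [← key]
  ring

theorem four_mul_mul (m k : ℤ) : 4 * ((k : ℝ) * m) =
    ((m + k).natAbs : ℝ) ^ 2 - ((m - k).natAbs : ℝ) ^ 2 := by
  rw [sq_natAbs_sub, sq_natAbs_add]
  ring

theorem diagEntry_add_minLevel (m k : ℤ) (n : ℕ) :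
    diagEntry m k (n + minLevel m k) =
      (((m + k).natAbs : ℝ) ^ 2 - ((m - k).natAbs : ℝ) ^ 2)
        / ((2 * n + (m - k).natAbs + (m + k).natAbs)
          * (2 * n + (m - k).natAbs + (m + k).natAbs + 2)) := by
  rw [← four_mul_mul, diagEntry, Nat.cast_add, cast_minLevel]
  rw [show (n + (((m - k).natAbs : ℝ) + (m + k).natAbs) / 2) *
      (n + (((m - k).natAbs : ℝ) + (m + k).natAbs) / 2 + 1) =
      ((2 * n + (m - k).natAbs + (m + k).natAbs)
          * (2 * n + (m - k).natAbs + (m + k).natAbs + 2)) / 4 by ring]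
  rw [div_div_eq_mul_div]
  ring

theorem diagEntry_minLevel (m k : ℤ) :
    diagEntry m k (minLevel m k) =
      (((m + k).natAbs : ℝ) - (m - k).natAbs) / ((m - k).natAbs + (m + k).natAbs + 2) := by
  have h := diagEntry_add_minLevel m k 0
  rw [zero_add] at h
  rw [h]
  generalize hA : (m - k).natAbs = a
  generalize hB : (m + k).natAbs = b
  rcases Nat.eq_zero_or_pos (a + b) with h0 | h0
  -- For `m = k = 0` the general quotient is `0 / 0 = 0`, which agrees with the right-hand side.
  · obtain rfl : a = 0 := by omega
    obtain rfl : b = 0 := by omega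
    simp
  · have h1 : (a + b : ℝ) ≠ 0 := by exact_mod_cast h0.ne'
    have h2 : (a + b + 2 : ℝ) ≠ 0 := by positivity
    simp only [Nat.cast_zero, mul_zero, zero_add]
    field_simp
    ring

/-- The product depends on `m`, `k` only through `k² + m² = (a² + b²) / 2` and `k m = (b² - a²) /
4`, with `a = |m - k|`, `b = |m + k|`. -/
theorem level_sq_mul_level_sq (m k : ℤ) (n : ℕ) :
    (((n + minLevel m k : ℕ) : ℝ) ^ 2 - (k : ℝ) ^ 2)
      * (((n + minLevel m k : ℕ) : ℝ) ^ 2 - (m : ℝ) ^ 2) =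
    n * (n + (m - k).natAbs) * (n + (m + k).natAbs) * (n + (m - k).natAbs + (m + k).natAbs) := by
  rw [Nat.cast_add, cast_minLevel]
  have h1 := sq_natAbs_sub m k
  have h2 := sq_natAbs_add m k
  generalize ((m - k).natAbs : ℝ) = a at *
  generalize ((m + k).natAbs : ℝ) = b at *
  have h3 : (k : ℝ) ^ 2 + m ^ 2 = (a ^ 2 + b ^ 2) / 2 := by
    rw [h1, h2]
    ring
  have h4 : (k : ℝ) * m = (b ^ 2 - a ^ 2) / 4 := by
    rw [h1, h2]
    ring
  have h5 : ((n + (a + b) / 2) ^ 2 - (k : ℝ) ^ 2) * ((n + (a + b) / 2) ^ 2 - (m : ℝ) ^ 2) =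
      (n + (a + b) / 2) ^ 4 - ((k : ℝ) ^ 2 + m ^ 2) * (n + (a + b) / 2) ^ 2
        + ((k : ℝ) * m) ^ 2 := by ring
  rw [h5, h3, h4]
  ring

theorem offDiagEntry_succ (m k : ℤ) (n : ℕ) :
    offDiagEntry m k (n + 1 + minLevel m k) =
      -√(jacobiOffDiagSq (m - k).natAbs (m + k).natAbs n) := by
  rw [offDiagEntry, level_sq_mul_level_sq, jacobiOffDiagSq, Nat.cast_add (n + 1), cast_minLevel]
  congr 2
  have h1 : (2 * n + (m - k).natAbs + (m + k).natAbs + 1 : ℝ) ≠ 0 := by positivity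
  have h2 : (2 * n + (m - k).natAbs + (m + k).natAbs + 2 : ℝ) ≠ 0 := by positivity
  have h3 : (2 * n + (m - k).natAbs + (m + k).natAbs + 3 : ℝ) ≠ 0 := by positivity
  generalize ((m - k).natAbs : ℝ) = a at *
  generalize ((m + k).natAbs : ℝ) = b at *
  have e : ((n + 1 : ℕ) + (a + b) / 2) ^ 2 * (4 * ((n + 1 : ℕ) + (a + b) / 2) ^ 2 - 1) =
      ((2 * n + a + b + 1) * (2 * n + a + b + 2) ^ 2 * (2 * n + a + b + 3)) / 4 := by
    push_cast
    ring
  rw [e, div_div_eq_mul_div]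
  push_cast
  ring

theorem sum_halfAngle (θ : ℝ) : -Real.sin (θ / 2) ^ 2 + Real.cos (θ / 2) ^ 2 = Real.cos θ := by
  rw [cos_eq_half θ]
  ring

theorem sub_halfAngle (θ : ℝ) : Real.cos (θ / 2) ^ 2 - -Real.sin (θ / 2) ^ 2 = 1 := by
  linarith [Real.sin_sq_add_cos_sq (θ / 2)]

theorem cos_mul_wignerTheta_minLevel (m k : ℤ) (θ : ℝ) :
    Real.cos θ * wignerTheta m k (minLevel m k) θ =
      diagEntry m k (minLevel m k) * wignerTheta m k (minLevel m k) θ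
        + offDiagEntry m k (1 + minLevel m k) * wignerTheta m k (1 + minLevel m k) θ := by
  have e0 := wignerTheta_add_minLevel m k 0 θ
  have e1 := wignerTheta_add_minLevel m k 1 θ
  have e2 := offDiagEntry_succ m k 0
  rw [zero_add] at e0 e2
  rw [e0, e1, e2, diagEntry_minLevel, wignerCore, wignerCore]
  have hr := jacobiHom_recurrence_zero (a := (m - k).natAbs) (b := (m + k).natAbs)
    (sub_halfAngle θ)
  rw [sum_halfAngle] at hr
  have hq := sqrt_jacobiOffDiagSq_mul_succ (m - k).natAbs (m + k).natAbs 0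
  generalize (m - k).natAbs = a at *
  generalize (m + k).natAbs = b at *
  have hq' : √(jacobiOffDiagSq a b 0) * √(wignerNormSq a b 1) =
      2 * ((1 + a) * (1 + b)) / (a + b + 2) * √(wignerNormSq a b 0) := by
    rw [hq]
    have h1 : (a + b + 1 : ℝ) ≠ 0 := by positivity
    simp only [Nat.cast_zero, mul_zero, zero_add]
    congr 1
    rw [div_eq_div_iff (by positivity) (by positivity)]
    ring
  rw [pow_add]
  generalize jacobiHom a b _ _ 0 = q0 at *
  generalize jacobiHom a b _ _ 1 = q1 at *
  linear_combination ((-1) ^ minLevel m k * √(wignerNormSq a b 0)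
    * (Real.sin (θ / 2) ^ a * Real.cos (θ / 2) ^ b)) * hr
    - ((-1) ^ minLevel m k * (Real.sin (θ / 2) ^ a * Real.cos (θ / 2) ^ b) * q1) * hq'

/-- The phases `(-1)^j` of neighbouring levels differ by a sign, which turns the positive
off-diagonal Jacobi coefficients into the negative `offDiagEntry`. -/
theorem cos_mul_wignerTheta_succ (m k : ℤ) (n : ℕ) (θ : ℝ) :
    Real.cos θ * wignerTheta m k (n + 1 + minLevel m k) θ =
      offDiagEntry m k (n + 1 + minLevel m k) * wignerTheta m k (n + minLevel m k) θ
        + diagEntry m k (n + 1 + minLevel m k) * wignerTheta m k (n + 1 + minLevel m k) θ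
        + offDiagEntry m k (n + 2 + minLevel m k) * wignerTheta m k (n + 2 + minLevel m k) θ := by
  rw [wignerTheta_add_minLevel, wignerTheta_add_minLevel, wignerTheta_add_minLevel,
    offDiagEntry_succ, offDiagEntry_succ m k (n + 1), diagEntry_add_minLevel, wignerCore,
    wignerCore, wignerCore]
  have hr := jacobiHom_recurrence (a := (m - k).natAbs) (b := (m + k).natAbs) n
    (sub_halfAngle θ)
  rw [sum_halfAngle] at hr
  have hq := sqrt_jacobiOffDiagSq_mul_succ (m - k).natAbs (m + k).natAbs (n + 1)
  have hp := sqrt_jacobiOffDiagSq_mul (m - k).natAbs (m + k).natAbs n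
  generalize (m - k).natAbs = a at *
  generalize (m + k).natAbs = b at *
  rw [pow_add (-1 : ℝ) (n + 1) (minLevel m k), pow_add (-1 : ℝ) (n + 2) (minLevel m k),
    pow_add (-1 : ℝ) n (minLevel m k), pow_succ (-1 : ℝ) n, pow_add (-1 : ℝ) n 2]
  generalize jacobiHom a b _ _ n = q0 at *
  generalize jacobiHom a b _ _ (n + 1) = q1 at *
  generalize jacobiHom a b _ _ (n + 2) = q2 at *
  have e1 : 2 * (((n + 1 : ℕ) + 1 : ℝ) * ((n + 1 : ℕ) + 1 + a) * ((n + 1 : ℕ) + 1 + b)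
      * ((n + 1 : ℕ) + 1 + a + b)) / ((2 * (n + 1 : ℕ) + a + b + 1) * (2 * (n + 1 : ℕ) + a + b + 2))
      = 2 * ((n + 2) * (n + 2 + a) * (n + 2 + b) * (n + 2 + a + b))
          / ((2 * n + a + b + 3) * (2 * n + a + b + 4)) := by
    push_cast
    congr 1 <;> ring
  have e2 : ((2 * (n + 1 : ℕ) + a + b) * (2 * (n + 1 : ℕ) + a + b + 2) : ℝ) =
      (2 * n + a + b + 2) * (2 * n + a + b + 4) := by
    push_cast
    ring
  rw [e1] at hq
  rw [e2]
  linear_combination (-(-1) ^ n * (-1) ^ minLevel m k * √(wignerNormSq a b (n + 1))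
    * (Real.sin (θ / 2) ^ a * Real.cos (θ / 2) ^ b)) * hr
    + ((-1) ^ n * (-1) ^ minLevel m k * (Real.sin (θ / 2) ^ a * Real.cos (θ / 2) ^ b) * q2) * hq
    + ((-1) ^ n * (-1) ^ minLevel m k * (Real.sin (θ / 2) ^ a * Real.cos (θ / 2) ^ b) * q0) * hp

end Wigner

/-! ### The Hilbert space, the potential as a bounded operator, and Lagrange's identity. -/

section WaveSpace

open scoped InnerProductSpace

theorem ae_thetaMeasure_mem : ∀ᵐ θ ∂thetaMeasure, θ ∈ Set.Ioo 0 Real.pi :=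
  (withDensity_absolutelyContinuous _ _).ae_le (ae_restrict_mem measurableSet_Ioo)

theorem integral_thetaMeasure (f : ℝ → ℂ) :
    ∫ θ, f θ ∂thetaMeasure = ∫ θ in (0 : ℝ)..Real.pi, (Real.sin θ : ℂ) * f θ := by
  rw [thetaMeasure, integral_withDensity_eq_integral_toReal_smul₀,
    intervalIntegral.integral_of_le Real.pi_pos.le, integral_Ioc_eq_integral_Ioo]
  · refine setIntegral_congr_fun measurableSet_Ioo fun θ hθ => ?_
    rw [ENNReal.toReal_ofReal (Real.sin_pos_of_pos_of_lt_pi hθ.1 hθ.2).le, Complex.real_smul]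
  · exact (ENNReal.measurable_ofReal.comp Real.measurable_sin).aemeasurable
  · exact Filter.Eventually.of_forall fun _ => ENNReal.ofReal_lt_top

instance : IsFiniteMeasure thetaMeasure := by
  refine isFiniteMeasure_withDensity_ofReal ?_
  exact ((Real.continuous_sin.integrableOn_Icc).mono_set Set.Ioo_subset_Icc_self).2

theorem memLp_of_continuous {u : ℝ → ℂ} (hu : Continuous u) : MemLp u 2 thetaMeasure := by
  obtain ⟨C, hC⟩ := (isCompact_Icc (a := (0 : ℝ)) (b := Real.pi)).exists_bound_of_continuousOn
    hu.continuousOn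
  refine MemLp.of_bound hu.aestronglyMeasurable C ?_
  filter_upwards [ae_thetaMeasure_mem] with θ hθ
  exact hC θ (Set.Ioo_subset_Icc_self hθ)

theorem inner_eq_integral {f g : Wave} {u v : ℝ → ℂ} (hu : (f : ℝ → ℂ) =ᵐ[thetaMeasure] u)
    (hv : (g : ℝ → ℂ) =ᵐ[thetaMeasure] v) :
    ⟪f, g⟫_ℂ = ∫ θ, (starRingEnd ℂ) (u θ) * v θ ∂thetaMeasure := by
  rw [L2.inner_def]
  refine integral_congr_ae ?_
  filter_upwards [hu, hv] with θ h1 h2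
  rw [h1, h2, RCLike.inner_apply, mul_comm]

/-! ### Multiplication by the cosine -/

theorem memLp_cos_mul (f : Wave) :
    MemLp (fun θ => (Real.cos θ : ℂ) * f θ) 2 thetaMeasure := by
  refine (Lp.memLp f).of_le ?_ (Filter.Eventually.of_forall fun θ => ?_)
  · exact (Complex.continuous_ofReal.comp Real.continuous_cos).aestronglyMeasurable.mul
      (Lp.aestronglyMeasurable f)
  · rw [norm_mul, Complex.norm_real]
    exact mul_le_of_le_one_left (norm_nonneg _) (Real.abs_cos_le_one θ)

/-- Multiplication by `cos θ` as a bounded operator. -/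
def cosOp : Wave →L[ℂ] Wave :=
  LinearMap.mkContinuous
    { toFun := fun f => (memLp_cos_mul f).toLp _
      map_add' := by
        intro f g
        rw [← MemLp.toLp_add]
        refine MemLp.toLp_congr _ _ ?_
        filter_upwards [Lp.coeFn_add f g] with θ h
        simp only [h, Pi.add_apply, mul_add]
      map_smul' := by
        intro c f
        rw [RingHom.id_apply, ← MemLp.toLp_const_smul]
        refine MemLp.toLp_congr _ _ ?_
        filter_upwards [Lp.coeFn_smul c f] with θ h
        simp only [h, Pi.smul_apply, smul_eq_mul]
        ring }
    1 (by
      intro f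
      refine Lp.norm_le_mul_norm_of_ae_le_mul ?_
      filter_upwards [(memLp_cos_mul f).coeFn_toLp] with θ h
      simp only [LinearMap.coe_mk, AddHom.coe_mk]
      rw [h, norm_mul, Complex.norm_real]
      exact mul_le_mul_of_nonneg_right (Real.abs_cos_le_one θ) (norm_nonneg _))

theorem coeFn_cosOp (f : Wave) :
    (cosOp f : ℝ → ℂ) =ᵐ[thetaMeasure] fun θ => (Real.cos θ : ℂ) * f θ :=
  (memLp_cos_mul f).coeFn_toLp

theorem cosOp_symm (f g : Wave) : ⟪cosOp f, g⟫_ℂ = ⟪f, cosOp g⟫_ℂ := by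
  rw [inner_eq_integral (coeFn_cosOp f) (Filter.EventuallyEq.refl _ (g : ℝ → ℂ)),
    inner_eq_integral (Filter.EventuallyEq.refl _ (f : ℝ → ℂ)) (coeFn_cosOp g)]
  congr 1
  funext θ
  rw [map_mul, Complex.conj_ofReal]
  ring

/-- Multiplication by the potential `c₁ cos θ + c₂ cos² θ`. -/
def potentialOp (c₁ c₂ : ℝ) : Wave →L[ℂ] Wave :=
  (c₁ : ℂ) • cosOp + (c₂ : ℂ) • (cosOp ∘L cosOp)

theorem potentialOp_apply (c₁ c₂ : ℝ) (f : Wave) :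
    potentialOp c₁ c₂ f = (c₁ : ℂ) • cosOp f + (c₂ : ℂ) • cosOp (cosOp f) := rfl

theorem coeFn_potentialOp (c₁ c₂ : ℝ) (f : Wave) :
    (potentialOp c₁ c₂ f : ℝ → ℂ) =ᵐ[thetaMeasure]
      fun θ => ((c₁ * Real.cos θ + c₂ * Real.cos θ ^ 2 : ℝ) : ℂ) * f θ := by
  rw [potentialOp_apply]
  filter_upwards [Lp.coeFn_add ((c₁ : ℂ) • cosOp f) ((c₂ : ℂ) • cosOp (cosOp f)),
    Lp.coeFn_smul (c₁ : ℂ) (cosOp f), Lp.coeFn_smul (c₂ : ℂ) (cosOp (cosOp f)), coeFn_cosOp f,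
    coeFn_cosOp (cosOp f)] with θ h1 h2 h3 h4 h5
  rw [h1, Pi.add_apply, h2, h3, Pi.smul_apply, Pi.smul_apply, h5, h4, smul_eq_mul, smul_eq_mul]
  push_cast
  ring

theorem potentialOp_symm (c₁ c₂ : ℝ) (f g : Wave) :
    ⟪potentialOp c₁ c₂ f, g⟫_ℂ = ⟪f, potentialOp c₁ c₂ g⟫_ℂ := by
  simp only [potentialOp_apply, inner_add_left, inner_add_right, inner_smul_left,
    inner_smul_right, Complex.conj_ofReal, cosOp_symm]

/-! ### The Wigner functions as elements of the Hilbert space -/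

variable {m k : ℤ}

theorem contDiff_wignerTheta (m k : ℤ) (n : ℕ) :
    ContDiff ℝ 2 (wignerTheta m k (n + minLevel m k)) := by
  have : wignerTheta m k (n + minLevel m k) = fun θ => (-1) ^ (n + minLevel m k) *
      (√(wignerNormSq (m - k).natAbs (m + k).natAbs n)
        * wignerCore (m - k).natAbs (m + k).natAbs n θ) :=
    funext (wignerTheta_add_minLevel m k n)
  rw [this]
  exact contDiff_const.mul (contDiff_const.mul (contDiff_wignerCore _ _ _))

theorem contDiff_ofReal_wignerTheta (m k : ℤ) (n : ℕ) :
    ContDiff ℝ 2 (fun θ => (wignerTheta m k (n + minLevel m k) θ : ℂ)) :=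
  Complex.ofRealCLM.contDiff.comp (contDiff_wignerTheta m k n)

/-- The Wigner function of level `max(|m|, |k|) + n` as an element of the Hilbert space. -/
def wignerWave (m k : ℤ) (n : ℕ) : Wave :=
  (memLp_of_continuous (contDiff_ofReal_wignerTheta m k n).continuous).toLp _

theorem coeFn_wignerWave (m k : ℤ) (n : ℕ) :
    (wignerWave m k n : ℝ → ℂ) =ᵐ[thetaMeasure]
      fun θ => (wignerTheta m k (n + minLevel m k) θ : ℂ) :=
  MemLp.coeFn_toLp _

theorem lSqReduced_const_mul (c : ℂ) (u : ℝ → ℂ) (θ : ℝ) :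
    lSqReduced m k (fun t => c * u t) θ = c * lSqReduced m k u θ := by
  have hd : deriv (fun t => c * u t) = fun t => c * deriv u t :=
    funext fun t => deriv_const_mul_field c
  have h : deriv (fun t => (Real.sin t : ℂ) * deriv (fun t => c * u t) t) θ =
      c * deriv (fun t => (Real.sin t : ℂ) * deriv u t) θ := by
    rw [← deriv_const_mul_field c, hd]
    congr 1
    funext t
    ring
  rw [lSqReduced, lSqReduced, h]
  ring

theorem lSqReduced_wignerTheta (m k : ℤ) (n : ℕ) {θ : ℝ} (hθ : θ ∈ Set.Ioo 0 Real.pi) :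
    lSqReduced m k (fun t => (wignerTheta m k (n + minLevel m k) t : ℂ)) θ =
      (((n + minLevel m k : ℕ) : ℂ) * (((n + minLevel m k : ℕ) : ℂ) + 1))
        * (wignerTheta m k (n + minLevel m k) θ : ℂ) := by
  have h1 : (fun t => (wignerTheta m k (n + minLevel m k) t : ℂ)) = fun t =>
      (((-1) ^ (n + minLevel m k) * √(wignerNormSq (m - k).natAbs (m + k).natAbs n) : ℝ) : ℂ)
        * (wignerCore (m - k).natAbs (m + k).natAbs n t : ℂ) := by
    funext t
    rw [wignerTheta_add_minLevel]
    push_cast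
    ring
  have h2 : ((n + minLevel m k : ℕ) : ℂ) =
      (((n : ℝ) + (((m - k).natAbs : ℝ) + ((m + k).natAbs : ℝ)) / 2 : ℝ) : ℂ) := by
    rw [← cast_minLevel, ← Nat.cast_add, Complex.ofReal_natCast]
  rw [h1, lSqReduced_const_mul, lSqReduced_wignerCore (sq_natAbs_sub m k) (sq_natAbs_add m k) n hθ,
    h2, wignerTheta_add_minLevel]
  push_cast
  ring

variable {ħ I₁ δ c₁ c₂ : ℝ}

/-- The eigenvalues of the Hamiltonian without potential. -/
def freeLevel (ħ I₁ δ : ℝ) (k : ℤ) (j : ℕ) : ℝ :=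
  ħ ^ 2 / (2 * I₁) * ((j : ℝ) * ((j : ℝ) + 1) + δ * (k : ℝ) ^ 2)

theorem wignerWave_mem_initialGraph (ħ I₁ δ c₁ c₂ : ℝ) (m k : ℤ) (n : ℕ) :
    (wignerWave m k n, (freeLevel ħ I₁ δ k (n + minLevel m k) : ℂ) • wignerWave m k n
      + potentialOp c₁ c₂ (wignerWave m k n)) ∈ initialGraph ħ I₁ δ c₁ c₂ m k := by
  refine ⟨_, contDiff_ofReal_wignerTheta m k n, coeFn_wignerWave m k n, ?_⟩
  filter_upwards [Lp.coeFn_add ((freeLevel ħ I₁ δ k (n + minLevel m k) : ℂ) • wignerWave m k n)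
      (potentialOp c₁ c₂ (wignerWave m k n)),
    Lp.coeFn_smul (freeLevel ħ I₁ δ k (n + minLevel m k) : ℂ) (wignerWave m k n),
    coeFn_potentialOp c₁ c₂ (wignerWave m k n), coeFn_wignerWave m k n, ae_thetaMeasure_mem]
    with θ h1 h2 h3 h4 hθ
  rw [h1, Pi.add_apply, h2, Pi.smul_apply, h3, h4, reducedHamiltonian,
    lSqReduced_wignerTheta m k n hθ, freeLevel]
  push_cast
  rw [smul_eq_mul]
  ring

/-- The initial operator is symmetric with respect to the Wigner functions. -/
theorem inner_wignerWave_of_mem_initialGraph {f g : Wave}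
    (h : (f, g) ∈ initialGraph ħ I₁ δ c₁ c₂ m k) (n : ℕ) :
    ⟪wignerWave m k n, g⟫_ℂ =
      freeLevel ħ I₁ δ k (n + minLevel m k) * ⟪wignerWave m k n, f⟫_ℂ
        + ⟪wignerWave m k n, potentialOp c₁ c₂ f⟫_ℂ := by
  obtain ⟨u, hu, hf, hg⟩ := h
  simp only at hf hg
  set E := freeLevel ħ I₁ δ k (n + minLevel m k) with hE
  set φ : ℝ → ℂ := fun θ => (wignerTheta m k (n + minLevel m k) θ : ℂ) with hφ
  have hφc : ContDiff ℝ 2 φ := contDiff_ofReal_wignerTheta m k n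
  have hr : ((g - (E : ℂ) • f - potentialOp c₁ c₂ f : Wave) : ℝ → ℂ) =ᵐ[thetaMeasure] fun θ =>
      reducedHamiltonian ħ I₁ δ c₁ c₂ m k u θ - E * u θ
        - ((c₁ * Real.cos θ + c₂ * Real.cos θ ^ 2 : ℝ) : ℂ) * u θ := by
    filter_upwards [Lp.coeFn_sub (g - (E : ℂ) • f) (potentialOp c₁ c₂ f),
      Lp.coeFn_sub g ((E : ℂ) • f), Lp.coeFn_smul (E : ℂ) f, coeFn_potentialOp c₁ c₂ f, hf, hg]
      with θ h1 h2 h3 h4 h5 h6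
    rw [h1, Pi.sub_apply, h2, Pi.sub_apply, h3, Pi.smul_apply, h4, h5, h6, smul_eq_mul]
  have hdiff : ∀ {v : ℝ → ℂ}, ContDiff ℝ 2 v → ContDiff ℝ 1 (deriv v) := fun hv =>
    ((contDiff_succ_iff_deriv (n := 1)).1 hv).2.2
  -- `W` is `sin θ` times a Wronskian. It is `C¹` up to the end points and vanishes there because
  -- `sin θ` does.
  set W : ℝ → ℂ := fun t => (Real.sin t : ℂ) * deriv u t * φ t
    - (Real.sin t : ℂ) * deriv φ t * u t with hW
  have hsin : ContDiff ℝ 1 (fun t : ℝ => (Real.sin t : ℂ)) :=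
    Complex.ofRealCLM.contDiff.comp Real.contDiff_sin
  have hWc : ContDiff ℝ 1 W :=
    ((hsin.mul (hdiff hu)).mul (hφc.of_le one_le_two)).sub
      ((hsin.mul (hdiff hφc)).mul (hu.of_le one_le_two))
  have hWd : ∀ θ, deriv W θ = deriv (fun t => (Real.sin t : ℂ) * deriv u t) θ * φ θ
      - deriv (fun t => (Real.sin t : ℂ) * deriv φ t) θ * u θ := by
    intro θ
    have h1 := (hasDeriv_sin_mul_deriv hu θ).hasDerivAt.mul
      (hφc.differentiable two_ne_zero θ).hasDerivAt
    have h2 := (hasDeriv_sin_mul_deriv hφc θ).hasDerivAt.mul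
      (hu.differentiable two_ne_zero θ).hasDerivAt
    have h3 : deriv W θ = _ := (h1.sub h2).deriv
    rw [h3]
    ring
  have key : ⟪wignerWave m k n, g - (E : ℂ) • f - potentialOp c₁ c₂ f⟫_ℂ = 0 := by
    rw [inner_eq_integral (coeFn_wignerWave m k n) hr, integral_thetaMeasure]
    -- Pointwise on `(0, π)` the `1 / sin²` terms cancel and a multiple of `W'` remains, so the
    -- singular potential is never integrated on its own.
    have h1 : ∫ θ in (0 : ℝ)..Real.pi, (Real.sin θ : ℂ) *
        ((starRingEnd ℂ) (wignerTheta m k (n + minLevel m k) θ : ℂ) *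
          (reducedHamiltonian ħ I₁ δ c₁ c₂ m k u θ - E * u θ
            - ((c₁ * Real.cos θ + c₂ * Real.cos θ ^ 2 : ℝ) : ℂ) * u θ)) =
        ∫ θ in (0 : ℝ)..Real.pi, (-((ħ ^ 2 / (2 * I₁) : ℝ) : ℂ)) * deriv W θ := by
      rw [intervalIntegral.integral_of_le Real.pi_pos.le, integral_Ioc_eq_integral_Ioo,
        intervalIntegral.integral_of_le Real.pi_pos.le, integral_Ioc_eq_integral_Ioo]
      refine setIntegral_congr_fun measurableSet_Ioo fun θ hθ => ?_
      have hs : (Real.sin θ : ℂ) ≠ 0 := by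
        exact_mod_cast (Real.sin_pos_of_pos_of_lt_pi hθ.1 hθ.2).ne'
      have hev := lSqReduced_wignerTheta m k n hθ
      rw [Complex.conj_ofReal, hWd, reducedHamiltonian, hE, freeLevel]
      change lSqReduced m k φ θ = _ * φ θ at hev
      change _ * (φ θ * _) = _
      rw [lSqReduced] at hev ⊢
      generalize deriv (fun t => (Real.sin t : ℂ) * deriv u t) θ = du at *
      generalize deriv (fun t => (Real.sin t : ℂ) * deriv φ t) θ = dφ at *
      generalize ((((m : ℝ) ^ 2 + (k : ℝ) ^ 2 - 2 * m * k * Real.cos θ) / Real.sin θ ^ 2 : ℝ) : ℂ)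
        = v at *
      generalize (Real.sin θ : ℂ) = s at hs hev ⊢
      generalize ħ ^ 2 / (2 * I₁) = κ
      have e1 : dφ = s * (v - ((n + minLevel m k : ℕ) : ℂ)
          * (((n + minLevel m k : ℕ) : ℂ) + 1)) * φ θ := by
        field_simp at hev
        linear_combination -hev
      rw [e1]
      push_cast
      field_simp
      ring
    rw [h1, intervalIntegral.integral_const_mul, intervalIntegral.integral_deriv_eq_sub
      (fun t _ => hWc.differentiable one_ne_zero t)
      ((hWc.continuous_deriv le_rfl).intervalIntegrable _ _)]
    simp [hW]
  rw [inner_sub_right, inner_sub_right, inner_smul_right] at key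
  linear_combination key

end WaveSpace

/-! ### The Wigner functions as a Hilbert basis, and the matrix of the cosine. -/

section WignerBasis

open scoped InnerProductSpace

variable {m k : ℤ}

theorem cosOp_wignerWave_zero (m k : ℤ) :
    cosOp (wignerWave m k 0) = (diagEntry m k (minLevel m k) : ℂ) • wignerWave m k 0
      + (offDiagEntry m k (1 + minLevel m k) : ℂ) • wignerWave m k 1 := by
  apply Lp.ext
  filter_upwards [coeFn_cosOp (wignerWave m k 0), coeFn_wignerWave m k 0, coeFn_wignerWave m k 1,
    Lp.coeFn_add ((diagEntry m k (minLevel m k) : ℂ) • wignerWave m k 0)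
      ((offDiagEntry m k (1 + minLevel m k) : ℂ) • wignerWave m k 1),
    Lp.coeFn_smul (diagEntry m k (minLevel m k) : ℂ) (wignerWave m k 0),
    Lp.coeFn_smul (offDiagEntry m k (1 + minLevel m k) : ℂ) (wignerWave m k 1)]
    with θ h1 h2 h3 h4 h5 h6
  rw [h1, h4, Pi.add_apply, h5, h6, Pi.smul_apply, Pi.smul_apply, h2, h3, zero_add, smul_eq_mul,
    smul_eq_mul]
  exact_mod_cast cos_mul_wignerTheta_minLevel m k θ

theorem cosOp_wignerWave_succ (m k : ℤ) (n : ℕ) :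
    cosOp (wignerWave m k (n + 1)) =
      (offDiagEntry m k (n + 1 + minLevel m k) : ℂ) • wignerWave m k n
      + (diagEntry m k (n + 1 + minLevel m k) : ℂ) • wignerWave m k (n + 1)
      + (offDiagEntry m k (n + 2 + minLevel m k) : ℂ) • wignerWave m k (n + 2) := by
  apply Lp.ext
  set p := (offDiagEntry m k (n + 1 + minLevel m k) : ℂ) with hp
  set q := (diagEntry m k (n + 1 + minLevel m k) : ℂ) with hq
  set r := (offDiagEntry m k (n + 2 + minLevel m k) : ℂ) with hr
  filter_upwards [coeFn_cosOp (wignerWave m k (n + 1)), coeFn_wignerWave m k n,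
    coeFn_wignerWave m k (n + 1), coeFn_wignerWave m k (n + 2),
    Lp.coeFn_add (p • wignerWave m k n + q • wignerWave m k (n + 1)) (r • wignerWave m k (n + 2)),
    Lp.coeFn_add (p • wignerWave m k n) (q • wignerWave m k (n + 1)),
    Lp.coeFn_smul p (wignerWave m k n), Lp.coeFn_smul q (wignerWave m k (n + 1)),
    Lp.coeFn_smul r (wignerWave m k (n + 2))]
    with θ h1 h2 h3 h4 h5 h6 h7 h8 h9
  rw [h1, h5, Pi.add_apply, h6, Pi.add_apply, h7, h8, h9, Pi.smul_apply, Pi.smul_apply,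
    Pi.smul_apply, h2, h3, h4, smul_eq_mul, smul_eq_mul, smul_eq_mul, hp, hq, hr]
  exact_mod_cast cos_mul_wignerTheta_succ m k n θ

/-! ### Orthonormality -/

theorem freeLevel_strictMono {ħ I₁ : ℝ} (hħ : 0 < ħ) (hI₁ : 0 < I₁) (δ : ℝ) (k : ℤ) :
    StrictMono (freeLevel ħ I₁ δ k) := by
  intro i j hij
  have h : (i : ℝ) < j := by exact_mod_cast hij
  have hi : (0 : ℝ) ≤ i := Nat.cast_nonneg i
  unfold freeLevel
  have hc : 0 < ħ ^ 2 / (2 * I₁) := by positivity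
  refine mul_lt_mul_of_pos_left ?_ hc
  nlinarith

/-- Both are eigenvectors of the free Hamiltonian with `ħ = I₁ = 1`, `δ = 0`, which is symmetric
against Wigner functions and has strictly increasing eigenvalues. -/
theorem inner_wignerWave_of_ne {i j : ℕ} (hij : i ≠ j) :
    ⟪wignerWave m k i, wignerWave m k j⟫_ℂ = 0 := by
  have h := inner_wignerWave_of_mem_initialGraph
    (wignerWave_mem_initialGraph 1 1 0 0 0 m k j) i
  have h0 : ∀ f : Wave, potentialOp 0 0 f = 0 := fun f => by simp [potentialOp_apply]
  rw [h0, add_zero, inner_zero_right, add_zero, inner_smul_right, ← sub_eq_zero,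
    ← sub_mul] at h
  refine (mul_eq_zero.1 h).resolve_left ?_
  rw [sub_eq_zero]
  intro he
  have he' := (freeLevel_strictMono one_pos one_pos 0 k).injective (Complex.ofReal_injective he)
  omega

theorem offDiagEntry_succ_ne_zero (m k : ℤ) (n : ℕ) :
    offDiagEntry m k (n + 1 + minLevel m k) ≠ 0 := by
  rw [offDiagEntry_succ, neg_ne_zero]
  exact (Real.sqrt_pos.2 (jacobiOffDiagSq_pos _ _ n)).ne'

/-- Evaluating `⟪w n, cos θ w (n + 1)⟫` with the cosine on either side gives the same nonzero entry
times one norm or the other. Only the lowest norm then needs an integral. -/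
theorem inner_wignerWave_succ_self (m k : ℤ) (n : ℕ) :
    ⟪wignerWave m k (n + 1), wignerWave m k (n + 1)⟫_ℂ =
      ⟪wignerWave m k n, wignerWave m k n⟫_ℂ := by
  have h := cosOp_symm (wignerWave m k n) (wignerWave m k (n + 1))
  have hne : (offDiagEntry m k (n + 1 + minLevel m k) : ℂ) ≠ 0 := by
    exact_mod_cast offDiagEntry_succ_ne_zero m k n
  have hr : ⟪wignerWave m k n, cosOp (wignerWave m k (n + 1))⟫_ℂ =
      offDiagEntry m k (n + 1 + minLevel m k) * ⟪wignerWave m k n, wignerWave m k n⟫_ℂ := by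
    rw [cosOp_wignerWave_succ, inner_add_right, inner_add_right, inner_smul_right,
      inner_smul_right, inner_smul_right,
      inner_wignerWave_of_ne (show n ≠ n + 1 by omega),
      inner_wignerWave_of_ne (show n ≠ n + 2 by omega)]
    ring
  have hl : ⟪cosOp (wignerWave m k n), wignerWave m k (n + 1)⟫_ℂ =
      offDiagEntry m k (n + 1 + minLevel m k)
        * ⟪wignerWave m k (n + 1), wignerWave m k (n + 1)⟫_ℂ := by
    rcases n with _ | n
    · rw [cosOp_wignerWave_zero, inner_add_left, inner_smul_left, inner_smul_left,
        inner_wignerWave_of_ne (show 0 ≠ 0 + 1 by omega), Complex.conj_ofReal,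
        Complex.conj_ofReal]
      ring
    · rw [cosOp_wignerWave_succ, inner_add_left, inner_add_left, inner_smul_left,
        inner_smul_left, inner_smul_left,
        inner_wignerWave_of_ne (show n ≠ n + 1 + 1 by omega),
        inner_wignerWave_of_ne (show n + 1 ≠ n + 1 + 1 by omega), Complex.conj_ofReal,
        Complex.conj_ofReal, Complex.conj_ofReal]
      ring
  rw [hl, hr] at h
  exact mul_left_cancel₀ hne h

/-- The difference of the two sides is half an integrated derivative: that of `sin(θ/2)^(2a+2)
cos(θ/2)^(2b+2)`, up to a constant factor, which vanishes at `0` and `π`. Together with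
`integral_sin_mul_halfPow_add` this determines the beta integrals inductively. -/
theorem integral_sin_mul_halfPow_rec (a b : ℕ) :
    (a + 1 : ℝ) * (∫ θ in (0 : ℝ)..Real.pi, Real.sin θ * halfPow (2 * a) (2 * (b + 1)) θ) =
      (b + 1) * ∫ θ in (0 : ℝ)..Real.pi, Real.sin θ * halfPow (2 * (a + 1)) (2 * b) θ := by
  have hc : ∀ A B, Continuous (fun θ => Real.sin θ * halfPow A B θ) := fun A B =>
    Real.continuous_sin.mul (contDiff_halfPow A B).continuous
  have hd : ∀ θ, HasDerivAt (halfPow (2 * (a + 1)) (2 * (b + 1)))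
      ((a + 1) / 2 * (Real.sin θ * halfPow (2 * a) (2 * (b + 1)) θ)
        - (b + 1) / 2 * (Real.sin θ * halfPow (2 * (a + 1)) (2 * b) θ)) θ := by
    intro θ
    refine (hasDerivAt_halfPow _ _ θ).congr_deriv ?_
    rw [halfPowDeriv, halfPow, halfPow, sin_eq_half θ, show 2 * (a + 1) - 1 = 2 * a + 1 by omega,
      show 2 * (b + 1) - 1 = 2 * b + 1 by omega]
    push_cast
    ring
  have h := intervalIntegral.integral_eq_sub_of_hasDerivAt (a := 0) (b := Real.pi)
    (fun θ _ => hd θ) ((((hc _ _).const_mul _).sub ((hc _ _).const_mul _)).intervalIntegrable _ _)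
  rw [intervalIntegral.integral_sub (((hc _ _).const_mul _).intervalIntegrable _ _)
    (((hc _ _).const_mul _).intervalIntegrable _ _), intervalIntegral.integral_const_mul,
    intervalIntegral.integral_const_mul] at h
  have e1 : halfPow (2 * (a + 1)) (2 * (b + 1)) Real.pi = 0 := by simp [halfPow]
  have e2 : halfPow (2 * (a + 1)) (2 * (b + 1)) 0 = 0 := by simp [halfPow]
  rw [e1, e2] at h
  linear_combination 2 * h

theorem integral_sin_mul_halfPow_add (a b : ℕ) :
    (∫ θ in (0 : ℝ)..Real.pi, Real.sin θ * halfPow (2 * (a + 1)) (2 * b) θ)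
      + (∫ θ in (0 : ℝ)..Real.pi, Real.sin θ * halfPow (2 * a) (2 * (b + 1)) θ) =
      ∫ θ in (0 : ℝ)..Real.pi, Real.sin θ * halfPow (2 * a) (2 * b) θ := by
  have hc : ∀ A B, Continuous (fun θ => Real.sin θ * halfPow A B θ) := fun A B =>
    Real.continuous_sin.mul (contDiff_halfPow A B).continuous
  rw [← intervalIntegral.integral_add ((hc _ _).intervalIntegrable _ _)
    ((hc _ _).intervalIntegrable _ _)]
  congr 1
  funext θ
  rw [halfPow, halfPow, halfPow]
  linear_combination (Real.sin θ * Real.sin (θ / 2) ^ (2 * a) * Real.cos (θ / 2) ^ (2 * b)) *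
    Real.sin_sq_add_cos_sq (θ / 2)

/-- Euler's beta integral in the variable `θ`. -/
theorem integral_sin_mul_halfPow (a b : ℕ) :
    ∫ θ in (0 : ℝ)..Real.pi, Real.sin θ * halfPow (2 * a) (2 * b) θ =
      2 * (a.factorial * b.factorial) / (a + b + 1).factorial := by
  induction a with
  | zero =>
    induction b with
    | zero => simp [halfPow]; norm_num
    | succ b ih =>
      have h1 := integral_sin_mul_halfPow_rec 0 b
      have h2 := integral_sin_mul_halfPow_add 0 b
      rw [ih] at h2
      have h3 : ((b : ℝ) + 2) ≠ 0 := by positivity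
      have h5 : ((0 + b + 1).factorial : ℝ) ≠ 0 := by positivity
      have h4 : ((b : ℝ) + 2) * ∫ θ in (0 : ℝ)..Real.pi,
          Real.sin θ * halfPow (2 * 0) (2 * (b + 1)) θ =
          (b + 1) * (2 * (Nat.factorial 0 * b.factorial) / (0 + b + 1).factorial) := by
        rw [← h2]
        simp only [Nat.cast_zero] at h1
        linear_combination h1
      refine mul_left_cancel₀ h3 ?_
      rw [h4, ← add_assoc, Nat.factorial_succ (0 + b + 1), Nat.factorial_succ b]
      push_cast
      have h6 : (0 + (b : ℝ) + 1 + 1) ≠ 0 := by positivity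
      field_simp
      ring
  | succ a ih =>
    have h1 := integral_sin_mul_halfPow_rec a b
    have h2 := integral_sin_mul_halfPow_add a b
    rw [ih] at h2
    have h3 : ((a : ℝ) + b + 2) ≠ 0 := by positivity
    have h5 : ((a + b + 1).factorial : ℝ) ≠ 0 := by positivity
    have h4 : ((a : ℝ) + b + 2) * ∫ θ in (0 : ℝ)..Real.pi,
        Real.sin θ * halfPow (2 * (a + 1)) (2 * b) θ =
        (a + 1) * (2 * (a.factorial * b.factorial) / (a + b + 1).factorial) := by
      rw [← h2]
      linear_combination -h1
    refine mul_left_cancel₀ h3 ?_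
    rw [h4, show a + 1 + b + 1 = a + b + 1 + 1 by ring, Nat.factorial_succ (a + b + 1),
      Nat.factorial_succ a]
    push_cast
    have h6 : ((a : ℝ) + b + 1 + 1) ≠ 0 := by positivity
    field_simp
    ring

theorem wignerTheta_minLevel (m k : ℤ) (θ : ℝ) :
    wignerTheta m k (0 + minLevel m k) θ = (-1) ^ minLevel m k *
      √(wignerNormSq (m - k).natAbs (m + k).natAbs 0)
        / ((m - k).natAbs.factorial * (m + k).natAbs.factorial)
        * halfPow (m - k).natAbs (m + k).natAbs θ := by
  rw [wignerTheta_add_minLevel, zero_add, wignerCore, halfPow, jacobiHom, jacobiSum]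
  simp [jacobiCoeff]
  ring

theorem inner_wignerWave_zero_self (m k : ℤ) :
    ⟪wignerWave m k 0, wignerWave m k 0⟫_ℂ = 1 := by
  rw [inner_eq_integral (coeFn_wignerWave m k 0) (coeFn_wignerWave m k 0), integral_thetaMeasure]
  have h : ∀ θ : ℝ, (Real.sin θ : ℂ) * ((starRingEnd ℂ) (wignerTheta m k (0 + minLevel m k) θ : ℂ)
      * (wignerTheta m k (0 + minLevel m k) θ : ℂ)) =
      ((wignerNormSq (m - k).natAbs (m + k).natAbs 0
        / ((m - k).natAbs.factorial * (m + k).natAbs.factorial) ^ 2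
        * (Real.sin θ * halfPow (2 * (m - k).natAbs) (2 * (m + k).natAbs) θ) : ℝ) : ℂ) := by
    intro θ
    rw [Complex.conj_ofReal, wignerTheta_minLevel, ← Complex.ofReal_mul, ← Complex.ofReal_mul]
    congr 1
    have h1 := Real.mul_self_sqrt (wignerNormSq_pos (m - k).natAbs (m + k).natAbs 0).le
    have h2 : ((-1 : ℝ) ^ minLevel m k) * (-1) ^ minLevel m k = 1 := by
      rw [← mul_pow]
      simp
    rw [halfPow, halfPow, pow_mul', pow_mul']
    linear_combination (wignerNormSq (m - k).natAbs (m + k).natAbs 0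
      / ((m - k).natAbs.factorial * (m + k).natAbs.factorial) ^ 2
      * (Real.sin θ * ((Real.sin (θ / 2) ^ (m - k).natAbs) ^ 2
        * (Real.cos (θ / 2) ^ (m + k).natAbs) ^ 2))) * h2
      + (((-1) ^ minLevel m k) ^ 2 / ((m - k).natAbs.factorial * (m + k).natAbs.factorial) ^ 2
      * (Real.sin θ * ((Real.sin (θ / 2) ^ (m - k).natAbs) ^ 2
        * (Real.cos (θ / 2) ^ (m + k).natAbs) ^ 2))) * h1
  simp only [h]
  rw [intervalIntegral.integral_ofReal, intervalIntegral.integral_const_mul,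
    integral_sin_mul_halfPow, wignerNormSq]
  generalize (m - k).natAbs = a
  generalize (m + k).natAbs = b
  rw [← Complex.ofReal_one]
  congr 1
  have h1 : (a.factorial : ℝ) ≠ 0 := by positivity
  have h2 : (b.factorial : ℝ) ≠ 0 := by positivity
  have h3 : ((a + b).factorial : ℝ) ≠ 0 := by positivity
  have h4 : (a + b + 1 : ℝ) ≠ 0 := by positivity
  simp only [zero_add, Nat.factorial_succ, Nat.factorial_zero]
  push_cast
  field_simp
  ring

theorem inner_wignerWave (m k : ℤ) (i j : ℕ) :
    ⟪wignerWave m k i, wignerWave m k j⟫_ℂ = if i = j then 1 else 0 := by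
  split_ifs with h
  · subst h
    induction i with
    | zero => exact inner_wignerWave_zero_self m k
    | succ i ih => rw [inner_wignerWave_succ_self, ih]
  · exact inner_wignerWave_of_ne h

/-! ### Completeness -/

theorem cosOp_mem_span {f : Wave} (hf : f ∈ Submodule.span ℂ (Set.range (wignerWave m k))) :
    cosOp f ∈ Submodule.span ℂ (Set.range (wignerWave m k)) := by
  have hw : ∀ n, wignerWave m k n ∈ Submodule.span ℂ (Set.range (wignerWave m k)) :=
    fun n => Submodule.subset_span ⟨n, rfl⟩
  induction hf using Submodule.span_induction with
  | mem x hx =>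
    obtain ⟨n, rfl⟩ := hx
    rcases n with _ | n
    · rw [cosOp_wignerWave_zero]
      exact add_mem (Submodule.smul_mem _ _ (hw _)) (Submodule.smul_mem _ _ (hw _))
    · rw [cosOp_wignerWave_succ]
      exact add_mem (add_mem (Submodule.smul_mem _ _ (hw _)) (Submodule.smul_mem _ _ (hw _)))
        (Submodule.smul_mem _ _ (hw _))
  | zero => simp
  | add x y _ _ hx hy => rw [map_add]; exact add_mem hx hy
  | smul c x _ hx => rw [map_smul]; exact Submodule.smul_mem _ _ hx

theorem coeFn_cosOp_pow (f : Wave) (n : ℕ) :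
    (((cosOp ^ n) f : Wave) : ℝ → ℂ) =ᵐ[thetaMeasure] fun θ => (Real.cos θ : ℂ) ^ n * f θ := by
  induction n with
  | zero => simp
  | succ n ih =>
    rw [pow_succ', mul_apply_eq_comp]
    filter_upwards [coeFn_cosOp ((cosOp ^ n) f), ih] with θ h1 h2
    rw [h1, h2]
    ring

theorem cosOp_pow_mem_span (m k : ℤ) (n : ℕ) :
    (cosOp ^ n) (wignerWave m k 0) ∈ Submodule.span ℂ (Set.range (wignerWave m k)) := by
  induction n with
  | zero => exact Submodule.subset_span ⟨0, rfl⟩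
  | succ n ih =>
    rw [pow_succ', mul_apply_eq_comp]
    exact cosOp_mem_span ih

/-- An integrable function whose moments in `cos θ` all vanish is zero. -/
theorem ae_eq_zero_of_moments {h : ℝ → ℂ} (hi : Integrable h thetaMeasure)
    (hm : ∀ n : ℕ, ∫ θ, (Real.cos θ : ℂ) ^ n * h θ ∂thetaMeasure = 0) :
    h =ᵐ[thetaMeasure] 0 := by
  have hint : ∀ {v : ℝ → ℂ}, Continuous v → Integrable (fun θ => v θ * h θ) thetaMeasure := by
    intro v hv
    obtain ⟨C, hC⟩ := (isCompact_Icc (a := (0 : ℝ)) (b := Real.pi)).exists_bound_of_continuousOn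
      hv.continuousOn
    refine hi.bdd_mul hv.aestronglyMeasurable (c := C) ?_
    filter_upwards [ae_thetaMeasure_mem] with θ hθ
    exact hC θ (Set.Ioo_subset_Icc_self hθ)
  have hpoly : ∀ p : Polynomial ℝ,
      ∫ θ, ((p.eval (Real.cos θ) : ℝ) : ℂ) * h θ ∂thetaMeasure = 0 := by
    intro p
    have hc : ∀ q : Polynomial ℝ, Continuous fun θ : ℝ => ((q.eval (Real.cos θ) : ℝ) : ℂ) :=
      fun q => Complex.continuous_ofReal.comp (q.continuous.comp Real.continuous_cos)
    induction p using Polynomial.induction_on' with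
    | add p q hp hq =>
      simp only [Polynomial.eval_add, Complex.ofReal_add, add_mul]
      rw [integral_add (hint (hc p)) (hint (hc q)), hp, hq, add_zero]
    | monomial n c =>
      simp only [Polynomial.eval_monomial, Complex.ofReal_mul, Complex.ofReal_pow, mul_assoc]
      rw [integral_const_mul, hm, mul_zero]
  refine ae_eq_zero_of_integral_contDiff_smul_eq_zero hi.locallyIntegrable fun g hg _ => ?_
  have hgc : Continuous g := hg.continuous
  have hgi : Integrable (fun θ => (g θ : ℂ) * h θ) thetaMeasure :=
    hint (Complex.continuous_ofReal.comp hgc)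
  set A := ∫ θ, ‖h θ‖ ∂thetaMeasure with hA
  have hA0 : 0 ≤ A := integral_nonneg fun _ => norm_nonneg _
  have hle : ∀ ε > 0, ‖∫ θ, g θ • h θ ∂thetaMeasure‖ ≤ ε * A := by
    intro ε hε
    -- Since `arccos` inverts `cos` on `(0, π)`, Weierstrass approximation of `g ∘ arccos` on `[-1,
    -- 1]` approximates `g` by polynomials in `cos θ`.
    obtain ⟨p, hp⟩ := exists_polynomial_near_of_continuousOn (-1) 1 (fun x => g (Real.arccos x))
      (hgc.comp Real.continuous_arccos).continuousOn ε hε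
    have hpi : Integrable (fun θ => ((p.eval (Real.cos θ) : ℝ) : ℂ) * h θ) thetaMeasure :=
      hint (Complex.continuous_ofReal.comp (p.continuous.comp Real.continuous_cos))
    have e : ∫ θ, g θ • h θ ∂thetaMeasure =
        ∫ θ, (((g θ - p.eval (Real.cos θ) : ℝ)) : ℂ) * h θ ∂thetaMeasure := by
      simp only [Complex.ofReal_sub, sub_mul, Complex.real_smul]
      rw [integral_sub hgi hpi, hpoly, sub_zero]
    rw [e, hA, ← integral_const_mul]
    refine norm_integral_le_of_norm_le (hi.norm.const_mul ε) ?_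
    filter_upwards [ae_thetaMeasure_mem] with θ hθ
    rw [norm_mul, Complex.norm_real]
    refine mul_le_mul_of_nonneg_right ?_ (norm_nonneg _)
    have := hp (Real.cos θ) ⟨Real.neg_one_le_cos θ, Real.cos_le_one θ⟩
    rw [Real.arccos_cos hθ.1.le hθ.2.le] at this
    rw [Real.norm_eq_abs, abs_sub_comm]
    exact this.le
  rw [← norm_le_zero_iff]
  refine le_of_forall_pos_le_add fun ε hε => ?_
  rw [zero_add]
  refine (hle (ε / (A + 1)) (by positivity)).trans ?_
  rw [div_mul_eq_mul_div, div_le_iff₀ (by positivity)]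
  nlinarith

/-- At the lowest level the Jacobi polynomial is constant, and the half-angle factors are positive
inside the interval. -/
theorem wignerTheta_minLevel_ne_zero (m k : ℤ) {θ : ℝ} (hθ : θ ∈ Set.Ioo 0 Real.pi) :
    wignerTheta m k (0 + minLevel m k) θ ≠ 0 := by
  have h1 : 0 < Real.sin (θ / 2) :=
    Real.sin_pos_of_pos_of_lt_pi (by linarith [hθ.1]) (by linarith [hθ.1, hθ.2])
  have h2 : 0 < Real.cos (θ / 2) :=
    Real.cos_pos_of_mem_Ioo ⟨by linarith [hθ.1, hθ.2], by linarith [hθ.2]⟩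
  have h3 := Real.sqrt_pos.2 (wignerNormSq_pos (m - k).natAbs (m + k).natAbs 0)
  rw [wignerTheta_minLevel, halfPow]
  have h4 : ((-1 : ℝ) ^ minLevel m k) ≠ 0 := pow_ne_zero _ (by norm_num)
  have h5 : ((m - k).natAbs.factorial : ℝ) ≠ 0 := by positivity
  have h6 : ((m + k).natAbs.factorial : ℝ) ≠ 0 := by positivity
  exact mul_ne_zero (div_ne_zero (mul_ne_zero h4 h3.ne') (mul_ne_zero h5 h6))
    (mul_ne_zero (pow_ne_zero _ h1.ne') (pow_ne_zero _ h2.ne'))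

/-- The span is stable under `cos θ`, so it contains `cos^n θ` times the lowest function `w`. A
vector `f` orthogonal to it makes all moments of `w f` vanish; then `w f = 0`, and `w` can be
divided out. -/
theorem span_wignerWave_orthogonal (m k : ℤ) :
    (Submodule.span ℂ (Set.range (wignerWave m k)))ᗮ = ⊥ := by
  rw [Submodule.eq_bot_iff]
  intro f hf
  set w : ℝ → ℂ := fun θ => (wignerTheta m k (0 + minLevel m k) θ : ℂ) with hw
  have hwm : MemLp w 2 thetaMeasure :=
    memLp_of_continuous (contDiff_ofReal_wignerTheta m k 0).continuous
  have hi : Integrable (fun θ => w θ * f θ) thetaMeasure :=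
    hwm.integrable_mul (Lp.memLp f)
  have hz := ae_eq_zero_of_moments hi (fun n => by
    have h1 := (Submodule.mem_orthogonal _ f).1 hf _ (cosOp_pow_mem_span m k n)
    have h2 : (((cosOp ^ n) (wignerWave m k 0) : Wave) : ℝ → ℂ) =ᵐ[thetaMeasure]
        fun θ => (Real.cos θ : ℂ) ^ n * w θ := by
      filter_upwards [coeFn_cosOp_pow (wignerWave m k 0) n, coeFn_wignerWave m k 0] with θ h3 h4
      rw [h3, h4]
    rw [inner_eq_integral h2 (Filter.EventuallyEq.refl _ (f : ℝ → ℂ))] at h1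
    rw [← h1]
    congr 1
    funext θ
    rw [map_mul, map_pow, Complex.conj_ofReal, hw, Complex.conj_ofReal, mul_assoc])
  apply Lp.ext
  filter_upwards [hz, Lp.coeFn_zero ℂ 2 thetaMeasure, ae_thetaMeasure_mem] with θ h1 h2 hθ
  rw [h2]
  refine (mul_eq_zero.1 h1).resolve_left ?_
  exact Complex.ofReal_ne_zero.2 (wignerTheta_minLevel_ne_zero m k hθ)

/-! ### The Hilbert basis -/

/-- The levels are numbered by the natural numbers. -/
def levelEquiv (m k : ℤ) : Level m k ≃ ℕ where
  toFun j := j.1 - minLevel m k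
  invFun n := ⟨n + minLevel m k, Nat.le_add_left _ _⟩
  left_inv j := Subtype.ext (Nat.sub_add_cancel j.2)
  right_inv n := Nat.add_sub_cancel n (minLevel m k)

theorem levelEquiv_add (m k : ℤ) (j : Level m k) : levelEquiv m k j + minLevel m k = j.1 :=
  Nat.sub_add_cancel j.2

theorem orthonormal_wignerWave (m k : ℤ) :
    Orthonormal ℂ fun j => wignerWave m k (levelEquiv m k j) := by
  classical
  rw [orthonormal_iff_ite]
  intro i j
  rw [inner_wignerWave]
  simp only [(levelEquiv m k).apply_eq_iff_eq]

/-- The Wigner functions as a Hilbert basis. -/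
def wignerBasis (m k : ℤ) : HilbertBasis (Level m k) ℂ Wave :=
  HilbertBasis.mkOfOrthogonalEqBot (orthonormal_wignerWave m k) (by
    have : (Set.range fun j => wignerWave m k (levelEquiv m k j)) = Set.range (wignerWave m k) :=
      (levelEquiv m k).surjective.range_comp (wignerWave m k)
    rw [this, span_wignerWave_orthogonal])

theorem wignerBasis_apply (m k : ℤ) (j : Level m k) :
    wignerBasis m k j = wignerWave m k (levelEquiv m k j) := by
  rw [wignerBasis, HilbertBasis.coe_mkOfOrthogonalEqBot]

theorem coeFn_wignerBasis (m k : ℤ) (j : Level m k) :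
    (wignerBasis m k j : ℝ → ℂ) =ᵐ[thetaMeasure] fun θ => (wignerTheta m k j.1 θ : ℂ) := by
  have h := coeFn_wignerWave m k (levelEquiv m k j)
  rwa [levelEquiv_add, ← wignerBasis_apply] at h

/-! ### Matrix elements -/

theorem inner_wignerBasis_eq_integral (i j : Level m k) {T : Wave →L[ℂ] Wave} {v : ℝ → ℝ}
    (hT : ∀ f, (T f : ℝ → ℂ) =ᵐ[thetaMeasure] fun θ => (v θ : ℂ) * f θ) :
    ⟪wignerBasis m k i, T (wignerBasis m k j)⟫_ℂ =
      ((∫ θ in (0 : ℝ)..Real.pi,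
        wignerTheta m k i.1 θ * v θ * wignerTheta m k j.1 θ * Real.sin θ : ℝ) : ℂ) := by
  have h : (T (wignerBasis m k j) : ℝ → ℂ) =ᵐ[thetaMeasure]
      fun θ => (v θ : ℂ) * (wignerTheta m k j.1 θ : ℂ) := by
    filter_upwards [hT (wignerBasis m k j), coeFn_wignerBasis m k j] with θ h1 h2
    rw [h1, h2]
  rw [inner_eq_integral (coeFn_wignerBasis m k i) h, integral_thetaMeasure,
    ← intervalIntegral.integral_ofReal]
  congr 1
  funext θ
  rw [Complex.conj_ofReal]
  push_cast
  ring

theorem inner_wignerBasis_cosOp (i j : Level m k) :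
    ⟪wignerBasis m k i, cosOp (wignerBasis m k j)⟫_ℂ = (H1 m k i j : ℂ) := by
  rw [wignerBasis_apply, wignerBasis_apply, H1, Matrix.of_apply, ← levelEquiv_add m k i,
    ← levelEquiv_add m k j]
  generalize levelEquiv m k i = p
  generalize levelEquiv m k j = q
  rcases q with _ | q
  · rw [cosOp_wignerWave_zero]
    simp only [inner_add_right, inner_smul_right, inner_wignerWave]
    by_cases h0 : p = 0
    · subst h0
      simp
    · by_cases h1 : p = 1
      · subst h1
        simp [add_comm, add_left_comm]
      · rw [if_neg h0, if_neg h1, if_neg (by omega), if_neg (by omega), if_neg (by omega)]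
        simp
  · rw [cosOp_wignerWave_succ]
    simp only [inner_add_right, inner_smul_right, inner_wignerWave]
    by_cases h0 : p = q
    · subst h0
      rw [if_pos rfl, if_neg (by omega), if_neg (by omega), if_neg (by omega), if_pos (by omega)]
      simp
    · by_cases h1 : p = q + 1
      · subst h1
        rw [if_neg (by omega), if_pos rfl, if_neg (by omega), if_pos rfl]
        simp
      · by_cases h2 : p = q + 2
        · subst h2
          rw [if_neg (by omega), if_neg (by omega), if_pos rfl, if_neg (by omega),
            if_neg (by omega), if_pos (by omega)]
          simp
        · rw [if_neg h0, if_neg h1, if_neg h2, if_neg (by omega), if_neg (by omega),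
            if_neg (by omega)]
          simp

theorem H1_symm (i j : Level m k) : H1 m k i j = H1 m k j i := by
  rw [← Complex.ofReal_inj, ← inner_wignerBasis_cosOp, ← inner_wignerBasis_cosOp, ← cosOp_symm,
    ← inner_conj_symm, inner_wignerBasis_cosOp, Complex.conj_ofReal]

theorem H1_eq_zero {i j : Level m k} (h : i.1 + 1 < j.1 ∨ j.1 + 1 < i.1) : H1 m k i j = 0 := by
  rw [H1, Matrix.of_apply, if_neg (by omega), if_neg (by omega), if_neg (by omega)]

/-- Row `i` vanishes beyond column `i + 1`. Finiteness is what lets `∑ᶠ` be a true sum instead of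
its default value zero. -/
theorem finite_support_H1_mul (i j : Level m k) :
    (Function.support fun l => H1 m k i l * H1 m k l j).Finite := by
  refine Set.Finite.subset ((Set.finite_Iic (i.1 + 1)).preimage
    (Subtype.val_injective.injOn)) fun l hl => ?_
  rw [Set.mem_preimage, Set.mem_Iic]
  by_contra hcon
  refine hl ?_
  simp only
  rw [H1_eq_zero (Or.inl (not_le.1 hcon)), zero_mul]

/-- Moving one cosine to the left and inserting the basis by Parseval gives the matrix product. -/
theorem inner_wignerBasis_cosOp_sq (i j : Level m k) :
    ⟪wignerBasis m k i, cosOp (cosOp (wignerBasis m k j))⟫_ℂ = (H1sq m k i j : ℂ) := by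
  have h := (wignerBasis m k).hasSum_inner_mul_inner (cosOp (wignerBasis m k i))
    (cosOp (wignerBasis m k j))
  have h2 : (fun l => ⟪cosOp (wignerBasis m k i), wignerBasis m k l⟫_ℂ
      * ⟪wignerBasis m k l, cosOp (wignerBasis m k j)⟫_ℂ) =
      fun l => ((H1 m k i l * H1 m k l j : ℝ) : ℂ) := by
    funext l
    rw [cosOp_symm, inner_wignerBasis_cosOp, inner_wignerBasis_cosOp, Complex.ofReal_mul]
  rw [h2] at h
  rw [← cosOp_symm, ← h.tsum_eq, ← Complex.ofReal_tsum,
    tsum_eq_finsum (finite_support_H1_mul i j)]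
  rfl

end WignerBasis

/-! ### Separation of variables and the substitution `z = cos θ`. -/

section Separation

variable {m k : ℤ}

theorem lz_sectorFun (m k : ℤ) (f : ℝ → ℂ) :
    lz (sectorFun m k f) = fun φ θ ψ => (m : ℂ) * sectorFun m k f φ θ ψ := by
  funext φ θ ψ
  have h : HasDerivAt (fun t : ℝ => Complex.exp (Complex.I * ((m : ℂ) * (t : ℂ) + (k : ℂ) * ψ)))
      (Complex.exp (Complex.I * ((m : ℂ) * φ + (k : ℂ) * ψ)) * (Complex.I * (m * 1))) φ :=
    ((((hasDerivAt_id φ).ofReal_comp.const_mul (m : ℂ)).add_const _).const_mul Complex.I).cexp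
  simp only [lz, sectorFun]
  rw [(h.mul_const (f θ)).deriv]
  linear_combination (-(m : ℂ) * Complex.exp (Complex.I * ((m : ℂ) * φ + (k : ℂ) * ψ)) * f θ)
    * Complex.I_mul_I

theorem L3_sectorFun (m k : ℤ) (f : ℝ → ℂ) :
    L3 (sectorFun m k f) = fun φ θ ψ => (k : ℂ) * sectorFun m k f φ θ ψ := by
  funext φ θ ψ
  have h : HasDerivAt (fun t : ℝ => Complex.exp (Complex.I * ((m : ℂ) * φ + (k : ℂ) * (t : ℂ))))
      (Complex.exp (Complex.I * ((m : ℂ) * φ + (k : ℂ) * ψ)) * (Complex.I * (k * 1))) ψ :=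
    ((((hasDerivAt_id ψ).ofReal_comp.const_mul (k : ℂ)).const_add _).const_mul Complex.I).cexp
  simp only [L3, sectorFun]
  rw [(h.mul_const (f θ)).deriv]
  linear_combination (-(k : ℂ) * Complex.exp (Complex.I * ((m : ℂ) * φ + (k : ℂ) * ψ)) * f θ)
    * Complex.I_mul_I

/-- Brings the result of one derivative back to sector form, so that the eigenvalue rules apply a
second time. -/
theorem const_mul_sectorFun (c : ℂ) (f : ℝ → ℂ) :
    (fun φ θ ψ => c * sectorFun m k f φ θ ψ) = sectorFun m k (fun θ => c * f θ) := by
  funext φ θ ψ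
  simp only [sectorFun]
  ring

theorem lSq_sectorFun (m k : ℤ) (f : ℝ → ℂ) :
    lSq (sectorFun m k f) = sectorFun m k (lSqReduced m k f) := by
  funext φ θ ψ
  have h1 : lz (lz (sectorFun m k f)) φ θ ψ = (m : ℂ) ^ 2 * sectorFun m k f φ θ ψ := by
    rw [lz_sectorFun, const_mul_sectorFun, lz_sectorFun]
    simp only [sectorFun]
    ring
  have h2 : L3 (L3 (sectorFun m k f)) φ θ ψ = (k : ℂ) ^ 2 * sectorFun m k f φ θ ψ := by
    rw [L3_sectorFun, const_mul_sectorFun, L3_sectorFun]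
    simp only [sectorFun]
    ring
  have h3 : lz (L3 (sectorFun m k f)) φ θ ψ = (m : ℂ) * k * sectorFun m k f φ θ ψ := by
    rw [L3_sectorFun, const_mul_sectorFun, lz_sectorFun]
    simp only [sectorFun]
    ring
  rw [lSq, h1, h2, h3]
  set e := Complex.exp (Complex.I * ((m : ℂ) * φ + (k : ℂ) * ψ)) with he
  have h4 : deriv (fun t => (Real.sin t : ℂ) * deriv (fun s => sectorFun m k f φ s ψ) t) θ =
      e * deriv (fun t => (Real.sin t : ℂ) * deriv f t) θ := by
    -- A constant passes through `deriv` in a field even where the function is not differentiable,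
    -- so no regularity of `f` is used.
    rw [← deriv_const_mul_field e]
    congr 1
    funext t
    have : deriv (fun s => sectorFun m k f φ s ψ) t = e * deriv f t := deriv_const_mul_field e
    rw [this]
    ring
  rw [h4]
  simp only [sectorFun, lSqReduced]
  push_cast
  ring

theorem topHamiltonian_sectorFun (ħ I₁ δ c₁ c₂ : ℝ) (m k : ℤ) (f : ℝ → ℂ) :
    topHamiltonian ħ I₁ δ c₁ c₂ (sectorFun m k f) =
      sectorFun m k (reducedHamiltonian ħ I₁ δ c₁ c₂ m k f) := by
  funext φ θ ψ
  have h2 : L3 (L3 (sectorFun m k f)) φ θ ψ = (k : ℂ) ^ 2 * sectorFun m k f φ θ ψ := by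
    rw [L3_sectorFun, const_mul_sectorFun, L3_sectorFun]
    simp only [sectorFun]
    ring
  rw [topHamiltonian, lSq_sectorFun, h2]
  simp only [sectorFun, reducedHamiltonian]
  push_cast
  ring

/-- The substitution `z = cos θ` in the Legendre part of the operator. -/
theorem deriv_sin_mul_deriv_comp_cos {u : ℝ → ℂ} (hu : ContDiffOn ℝ 2 u (Set.Ioo (-1) 1)) {θ : ℝ}
    (hθ : θ ∈ Set.Ioo 0 Real.pi) :
    deriv (fun t => (Real.sin t : ℂ) * deriv (fun s => u (Real.cos s)) t) θ =
      Real.sin θ * deriv (fun t => ((1 - t ^ 2 : ℝ) : ℂ) * deriv u t) (Real.cos θ) := by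
  have hcos : ∀ t ∈ Set.Ioo 0 Real.pi, Real.cos t ∈ Set.Ioo (-1 : ℝ) 1 := fun t ht =>
    ⟨by
      have := Real.cos_lt_cos_of_nonneg_of_le_pi ht.1.le le_rfl ht.2
      rwa [Real.cos_pi] at this, by
      have := Real.cos_lt_cos_of_nonneg_of_le_pi le_rfl ht.2.le ht.1
      rwa [Real.cos_zero] at this⟩
  have hu1 : ∀ z ∈ Set.Ioo (-1 : ℝ) 1, DifferentiableAt ℝ u z := fun z hz =>
    (hu.differentiableOn two_ne_zero).differentiableAt (isOpen_Ioo.mem_nhds hz)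
  have hu2 : DifferentiableAt ℝ (deriv u) (Real.cos θ) :=
    (((contDiffOn_succ_iff_deriv_of_isOpen (n := 1) isOpen_Ioo).1 hu).2.2.differentiableOn
      one_ne_zero).differentiableAt (isOpen_Ioo.mem_nhds (hcos θ hθ))
  have e : (fun t => (Real.sin t : ℂ) * deriv (fun s => u (Real.cos s)) t) =ᶠ[nhds θ]
      fun t => -((fun z => ((1 - z ^ 2 : ℝ) : ℂ) * deriv u z) (Real.cos t)) := by
    filter_upwards [isOpen_Ioo.mem_nhds hθ] with t ht
    have h : HasDerivAt (fun s => u (Real.cos s)) ((-Real.sin t) • deriv u (Real.cos t)) t :=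
      (hu1 _ (hcos t ht)).hasDerivAt.scomp t (Real.hasDerivAt_cos t)
    rw [h.deriv, ← Real.sin_sq, Complex.real_smul]
    push_cast
    ring
  have hp : HasDerivAt (fun z : ℝ => ((1 - z ^ 2 : ℝ) : ℂ) * deriv u z)
      (deriv (fun z : ℝ => ((1 - z ^ 2 : ℝ) : ℂ) * deriv u z) (Real.cos θ)) (Real.cos θ) := by
    refine DifferentiableAt.hasDerivAt (DifferentiableAt.mul ?_ hu2)
    exact (Complex.ofRealCLM.contDiff.comp (contDiff_const.sub (contDiff_id.pow 2)) :
      ContDiff ℝ 1 fun z : ℝ => ((1 - z ^ 2 : ℝ) : ℂ)).differentiable one_ne_zero _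
  have h2 := (hp.scomp θ (Real.hasDerivAt_cos θ)).neg
  rw [e.deriv_eq]
  refine h2.deriv.trans ?_
  rw [Complex.real_smul]
  push_cast
  ring

/-- Pointwise, the two equations differ only by the nonzero factor `ħ² / (2 I₁)`. -/
theorem reducedHamiltonian_eq_iff_heunOperator {ħ I₁ : ℝ} (hħ : 0 < ħ) (hI₁ : 0 < I₁)
    (δ c₁ c₂ : ℝ) (m k : ℤ) (E : ℂ) {u : ℝ → ℂ} (hu : ContDiffOn ℝ 2 u (Set.Ioo (-1) 1)) {θ : ℝ}
    (hθ : θ ∈ Set.Ioo 0 Real.pi) :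
    reducedHamiltonian ħ I₁ δ c₁ c₂ m k (fun t => u (Real.cos t)) θ = E * u (Real.cos θ) ↔
      heunOperator m k (c₁ * (2 * I₁) / ħ ^ 2) (c₂ * (2 * I₁) / ħ ^ 2)
        (2 * (I₁ : ℂ) * E / (ħ : ℂ) ^ 2 - (δ : ℂ) * (k : ℂ) ^ 2) u (Real.cos θ) = 0 := by
  have hs : (Real.sin θ : ℂ) ≠ 0 := by
    exact_mod_cast (Real.sin_pos_of_pos_of_lt_pi hθ.1 hθ.2).ne'
  have h1 : (ħ : ℂ) ≠ 0 := by exact_mod_cast hħ.ne'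
  have h2 : (I₁ : ℂ) ≠ 0 := by exact_mod_cast hI₁.ne'
  rw [reducedHamiltonian, lSqReduced, deriv_sin_mul_deriv_comp_cos hu hθ, heunOperator,
    ← Real.sin_sq θ]
  generalize deriv (fun t => ((1 - t ^ 2 : ℝ) : ℂ) * deriv u t) (Real.cos θ) = D
  have e1 : -(1 / (Real.sin θ : ℂ)) * ((Real.sin θ : ℂ) * D) = -D := by
    field_simp
  have e2 : ((m : ℝ) ^ 2 + (k : ℝ) ^ 2 - 2 * m * k * Real.cos θ) / Real.sin θ ^ 2 =
      ((k : ℝ) ^ 2 + (m : ℝ) ^ 2 - 2 * k * m * Real.cos θ) / Real.sin θ ^ 2 := by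
    ring
  rw [e1, e2]
  generalize ((k : ℝ) ^ 2 + (m : ℝ) ^ 2 - 2 * k * m * Real.cos θ) / Real.sin θ ^ 2 = v
  generalize u (Real.cos θ) = w
  generalize Real.cos θ = z
  push_cast
  constructor
  · intro h
    field_simp at h ⊢
    linear_combination h
  · intro h
    field_simp at h ⊢
    linear_combination h

end Separation

/-! ### Symmetry and band structure of the matrix. -/

section MatrixEntries

variable {m k : ℤ}

theorem H0_apply (ħ I₁ δ : ℝ) (m k : ℤ) (i j : Level m k) :
    H0 ħ I₁ δ m k i j = if i = j then freeLevel ħ I₁ δ k j.1 else 0 := by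
  rw [H0, Matrix.diagonal_apply]
  split_ifs with h
  · rw [h, freeLevel]
  · rfl

theorem topMatrix_apply (ħ I₁ δ c₁ c₂ : ℝ) (m k : ℤ) (i j : Level m k) :
    topMatrix ħ I₁ δ c₁ c₂ m k i j =
      H0 ħ I₁ δ m k i j + c₁ * H1 m k i j + c₂ * H1sq m k i j := rfl

theorem isSymm_topMatrix (ħ I₁ δ c₁ c₂ : ℝ) (m k : ℤ) :
    (topMatrix ħ I₁ δ c₁ c₂ m k).IsSymm := by
  refine Matrix.IsSymm.ext fun i j => ?_
  have h0 : H0 ħ I₁ δ m k j i = H0 ħ I₁ δ m k i j :=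
    (Matrix.isSymm_diagonal _).apply i j
  have h2 : H1sq m k j i = H1sq m k i j := by
    rw [H1sq, Matrix.of_apply, Matrix.of_apply]
    refine finsum_congr fun l => ?_
    rw [H1_symm j l, H1_symm l i, mul_comm]
  rw [topMatrix_apply, topMatrix_apply, h0, H1_symm j i, h2]

theorem topMatrix_eq_zero (ħ I₁ δ c₁ c₂ : ℝ) {i j : Level m k}
    (h : i.1 + 2 < j.1 ∨ j.1 + 2 < i.1) : topMatrix ħ I₁ δ c₁ c₂ m k i j = 0 := by
  have hij : i ≠ j := by
    rintro rfl
    omega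
  have h2 : H1sq m k i j = 0 := by
    rw [H1sq, Matrix.of_apply]
    refine finsum_eq_zero_of_forall_eq_zero fun l => ?_
    by_cases hl : i.1 + 1 < l.1 ∨ l.1 + 1 < i.1
    · rw [H1_eq_zero hl, zero_mul]
    · rw [H1_eq_zero (i := l) (j := j) (by omega), mul_zero]
  rw [topMatrix_apply, H0_apply, if_neg hij, H1_eq_zero (by omega), h2]
  ring

/-- Two tridiagonal steps lead from `i` to `i + 2` only through `i + 1`, so a single term of the
square survives. -/
theorem topMatrix_add_two (ħ I₁ δ c₁ c₂ : ℝ) {i j : Level m k} (h : i.1 + 2 = j.1) :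
    topMatrix ħ I₁ δ c₁ c₂ m k i j =
      c₂ * (offDiagEntry m k (i.1 + 1) * offDiagEntry m k (i.1 + 2)) := by
  have hij : i ≠ j := by
    rintro rfl
    omega
  have h2 : H1sq m k i j = offDiagEntry m k (i.1 + 1) * offDiagEntry m k (i.1 + 2) := by
    rw [H1sq, Matrix.of_apply, finsum_eq_single _ (⟨i.1 + 1, i.2.trans (Nat.le_succ _)⟩ : Level m k)]
    · simp only [H1, Matrix.of_apply]
      rw [if_neg (by omega), if_pos trivial, if_neg (by omega), if_pos (by omega), ← h]
    · intro l hl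
      have hl' : l.1 ≠ i.1 + 1 := fun h => hl (Subtype.ext h)
      by_cases hl2 : i.1 + 1 < l.1 ∨ l.1 + 1 < i.1
      · rw [H1_eq_zero hl2, zero_mul]
      · rw [H1_eq_zero (i := l) (j := j) (by omega), mul_zero]
  rw [topMatrix_apply, H0_apply, if_neg hij, H1_eq_zero (by omega), h2]
  ring

end MatrixEntries

/-! ### The closed Hamiltonian, its matrix and its spectrum. -/

section Hamiltonian

open scoped InnerProductSpace

/-- The entries of `topMatrix` are the matrix elements of the Hamiltonian. -/
theorem topMatrix_eq_inner (ħ I₁ δ c₁ c₂ : ℝ) (m k : ℤ) (i j : Level m k) :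
    (topMatrix ħ I₁ δ c₁ c₂ m k i j : ℂ) =
      ⟪wignerBasis m k i, (freeLevel ħ I₁ δ k j.1 : ℂ) • wignerBasis m k j
        + potentialOp c₁ c₂ (wignerBasis m k j)⟫_ℂ := by
  classical
  rw [potentialOp_apply, inner_add_right, inner_add_right, inner_smul_right, inner_smul_right,
    inner_smul_right, inner_wignerBasis_cosOp, inner_wignerBasis_cosOp_sq,
    inner_basis_eq_ite, topMatrix_apply, H0_apply]
  split_ifs <;> push_cast <;> ring

theorem graph_initialHamiltonian (ħ I₁ δ c₁ c₂ : ℝ) (m k : ℤ) :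
    (initialHamiltonian ħ I₁ δ c₁ c₂ m k).graph = initialGraph ħ I₁ δ c₁ c₂ m k :=
  Submodule.toLinearPMap_graph_eq _ (initialGraph_single_valued ħ I₁ δ c₁ c₂ m k)

/-- The Wigner functions lie in the initial domain, and Lagrange's identity bounds the initial graph
from above: the two hypotheses of `closure_graph_eq`. -/
theorem graph_hamiltonian (ħ I₁ δ c₁ c₂ : ℝ) (m k : ℤ) :
    (initialHamiltonian ħ I₁ δ c₁ c₂ m k).IsClosable ∧
      (hamiltonian ħ I₁ δ c₁ c₂ m k).graph =
        perturbedDiagGraph (wignerBasis m k) (fun j => freeLevel ħ I₁ δ k j.1)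
          (potentialOp c₁ c₂) := by
  refine closure_graph_eq (fun j => ?_) ?_
  · rw [graph_initialHamiltonian, wignerBasis_apply, ← levelEquiv_add m k j]
    exact wignerWave_mem_initialGraph ħ I₁ δ c₁ c₂ m k _
  · rw [graph_initialHamiltonian]
    rintro ⟨f, g⟩ h j
    simp only
    rw [wignerBasis_apply, ← levelEquiv_add m k j]
    exact inner_wignerWave_of_mem_initialGraph h _

theorem hamiltonian_wignerBasis (ħ I₁ δ c₁ c₂ : ℝ) (m k : ℤ) (j : Level m k) :
    ∃ h : wignerBasis m k j ∈ (hamiltonian ħ I₁ δ c₁ c₂ m k).domain,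
      hamiltonian ħ I₁ δ c₁ c₂ m k ⟨wignerBasis m k j, h⟩ =
        (freeLevel ħ I₁ δ k j.1 : ℂ) • wignerBasis m k j
          + potentialOp c₁ c₂ (wignerBasis m k j) := by
  have h : (wignerBasis m k j, (freeLevel ħ I₁ δ k j.1 : ℂ) • wignerBasis m k j
      + potentialOp c₁ c₂ (wignerBasis m k j)) ∈ (hamiltonian ħ I₁ δ c₁ c₂ m k).graph := by
    rw [(graph_hamiltonian ħ I₁ δ c₁ c₂ m k).2]
    exact basis_mem_perturbedDiagGraph (d := fun j : Level m k => freeLevel ħ I₁ δ k j.1) j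
  obtain ⟨⟨x, hx⟩, h1, h2⟩ := (LinearPMap.mem_graph_iff _).1 h
  simp only at h1 h2
  subst h1
  exact ⟨hx, h2⟩

theorem mem_graph_hamiltonian_iff (ħ I₁ δ c₁ c₂ : ℝ) (m k : ℤ) (f g : Wave) :
    (f, g) ∈ (hamiltonian ħ I₁ δ c₁ c₂ m k).graph ↔
      ∀ i, HasSum (fun j => (topMatrix ħ I₁ δ c₁ c₂ m k i j : ℂ) * (wignerBasis m k).repr f j)
        ((wignerBasis m k).repr g i) := by
  rw [(graph_hamiltonian ħ I₁ δ c₁ c₂ m k).2]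
  exact mem_perturbedDiagGraph_iff_hasSum (topMatrix_eq_inner ħ I₁ δ c₁ c₂ m k)

theorem mem_graph_matrixOperator_iff {ι : Type*} (M : Matrix ι ι ℝ)
    (x y : lp (fun _ : ι => ℂ) 2) :
    (x, y) ∈ (matrixOperator M).graph ↔ ∀ i, HasSum (fun j => (M i j : ℂ) * x j) (y i) := by
  rw [matrixOperator, Submodule.toLinearPMap_graph_eq _ (matrixGraph_single_valued M)]
  exact Iff.rfl

/-- The Wigner basis transforms the Hamiltonian into the matrix operator. -/
theorem mem_graph_hamiltonian_iff_matrixOperator (ħ I₁ δ c₁ c₂ : ℝ) (m k : ℤ) (f g : Wave) :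
    (f, g) ∈ (hamiltonian ħ I₁ δ c₁ c₂ m k).graph ↔
      ((wignerBasis m k).repr f, (wignerBasis m k).repr g) ∈
        (matrixOperator (topMatrix ħ I₁ δ c₁ c₂ m k)).graph := by
  rw [mem_graph_hamiltonian_iff, mem_graph_matrixOperator_iff]

/-- The shift is chosen so that the difference is `ħ² / (2 I₁)` times `j (j + 1) + 1`: never zero,
even at `j = 0`, and of quadratic growth. -/
theorem summable_inv_freeLevel_sub {ħ I₁ : ℝ} (hħ : 0 < ħ) (hI₁ : 0 < I₁) (δ : ℝ) (m k : ℤ) :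
    Summable fun j : Level m k =>
      (freeLevel ħ I₁ δ k j.1 - ħ ^ 2 / (2 * I₁) * (δ * (k : ℝ) ^ 2 - 1))⁻¹ := by
  have hc : 0 < ħ ^ 2 / (2 * I₁) := by positivity
  have h1 : Summable fun j : ℕ => (ħ ^ 2 / (2 * I₁) * ((j : ℝ) * (j + 1) + 1))⁻¹ := by
    simp only [mul_inv]
    refine Summable.mul_left _ ?_
    refine Summable.of_norm_bounded_eventually_nat (Real.summable_nat_pow_inv.2 one_lt_two) ?_
    filter_upwards [Filter.eventually_gt_atTop 0] with j hj
    have hj' : (0 : ℝ) < j := by exact_mod_cast hj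
    rw [norm_inv, Real.norm_of_nonneg (by positivity)]
    exact inv_anti₀ (by positivity) (by nlinarith)
  refine (h1.comp_injective Subtype.val_injective).congr fun j => ?_
  simp only [Function.comp_apply, freeLevel]
  congr 1
  ring

theorem mem_spectrumOf_hamiltonian_iff {ħ I₁ : ℝ} (hħ : 0 < ħ) (hI₁ : 0 < I₁) (δ c₁ c₂ : ℝ)
    (m k : ℤ) (z : ℂ) :
    z ∈ spectrumOf (hamiltonian ħ I₁ δ c₁ c₂ m k) ↔
      ∃ x : lp (fun _ : Level m k => ℂ) 2, x ≠ 0 ∧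
        ∀ i, HasSum (fun j => (topMatrix ħ I₁ δ c₁ c₂ m k i j : ℂ) * x j) (z * x i) := by
  have hc : 0 < ħ ^ 2 / (2 * I₁) := by positivity
  have hμ : ∀ j : Level m k,
      freeLevel ħ I₁ δ k j.1 ≠ ħ ^ 2 / (2 * I₁) * (δ * (k : ℝ) ^ 2 - 1) := by
    intro j
    refine ne_of_gt ?_
    unfold freeLevel
    refine mul_lt_mul_of_pos_left ?_ hc
    have : (0 : ℝ) ≤ (j.1 : ℝ) * (j.1 + 1) := by positivity
    linarith
  rw [mem_spectrumOf_iff_eigenvalue (graph_hamiltonian ħ I₁ δ c₁ c₂ m k).2 hμ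
    (summable_inv_freeLevel_sub hħ hI₁ δ m k) z]
  constructor
  · rintro ⟨x, hx, h⟩
    refine ⟨(wignerBasis m k).repr x, by simpa using hx, fun i => ?_⟩
    have := (mem_graph_hamiltonian_iff ħ I₁ δ c₁ c₂ m k _ _).1 h i
    rwa [map_smul] at this
  · rintro ⟨x, hx, h⟩
    refine ⟨(wignerBasis m k).repr.symm x, by simpa using hx, ?_⟩
    rw [mem_graph_hamiltonian_iff]
    intro i
    rw [map_smul, LinearIsometryEquiv.apply_symm_apply]
    exact h i

end Hamiltonian

end

end HarmonicTop

theorem theorem4 (ħ I₁ δ c₁ c₂ : ℝ) (hħ : 0 < ħ) (hI₁ : 0 < I₁) (m k : ℤ) :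
    -- separation: on the joint eigenspace of `lz`, `L3` the top is the reduced operator
    (∀ f : ℝ → ℂ, ContDiffOn ℝ 2 f (Set.Ioo 0 Real.pi) → ∀ φ ψ : ℝ, ∀ θ ∈ Set.Ioo 0 Real.pi,
      lz (sectorFun m k f) φ θ ψ = (m : ℂ) * sectorFun m k f φ θ ψ ∧
      L3 (sectorFun m k f) φ θ ψ = (k : ℂ) * sectorFun m k f φ θ ψ ∧
      lSq (sectorFun m k f) φ θ ψ = sectorFun m k (lSqReduced m k f) φ θ ψ ∧
      topHamiltonian ħ I₁ δ c₁ c₂ (sectorFun m k f) φ θ ψ =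
        sectorFun m k (reducedHamiltonian ħ I₁ δ c₁ c₂ m k f) φ θ ψ) ∧
    -- the eigenvalue equation is the confluent Heun equation in `z = cos θ`
    (∀ (E : ℂ) (u : ℝ → ℂ), ContDiffOn ℝ 2 u (Set.Ioo (-1) 1) →
      ((∀ θ ∈ Set.Ioo 0 Real.pi,
          reducedHamiltonian ħ I₁ δ c₁ c₂ m k (fun t => u (Real.cos t)) θ =
            E * u (Real.cos θ)) ↔
        ∀ z ∈ Set.Ioo (-1 : ℝ) 1,
          heunOperator m k (c₁ * (2 * I₁) / ħ ^ 2) (c₂ * (2 * I₁) / ħ ^ 2)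
            (2 * (I₁ : ℂ) * E / (ħ : ℂ) ^ 2 - (δ : ℂ) * (k : ℂ) ^ 2) u z = 0)) ∧
    -- the Wigner functions are joint eigenfunctions of `lz`, `L3` and `lSq`
    (∀ j : Level m k, ∀ φ ψ : ℝ, ∀ θ ∈ Set.Ioo 0 Real.pi,
      lz (wignerD m k j.1) φ θ ψ = (m : ℂ) * wignerD m k j.1 φ θ ψ ∧
      L3 (wignerD m k j.1) φ θ ψ = (k : ℂ) * wignerD m k j.1 φ θ ψ ∧
      lSq (wignerD m k j.1) φ θ ψ =
        (j.1 : ℂ) * ((j.1 : ℂ) + 1) * wignerD m k j.1 φ θ ψ) ∧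
    -- `H1` and `H1²` are the matrices of `cos θ` and `cos² θ`
    (∀ i j : Level m k,
      ∫ θ in (0 : ℝ)..Real.pi,
        wignerTheta m k i.1 θ * Real.cos θ * wignerTheta m k j.1 θ * Real.sin θ = H1 m k i j) ∧
    (∀ i j : Level m k,
      ∫ θ in (0 : ℝ)..Real.pi,
        wignerTheta m k i.1 θ * Real.cos θ ^ 2 * wignerTheta m k j.1 θ * Real.sin θ
          = H1sq m k i j) ∧
    -- the matrix is symmetric and pentadiagonal
    (topMatrix ħ I₁ δ c₁ c₂ m k).IsSymm ∧
    (∀ i j : Level m k, i.1 + 2 < j.1 ∨ j.1 + 2 < i.1 → topMatrix ħ I₁ δ c₁ c₂ m k i j = 0) ∧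
    (∀ i j : Level m k, i.1 + 2 = j.1 →
      topMatrix ħ I₁ δ c₁ c₂ m k i j
        = c₂ * (offDiagEntry m k (i.1 + 1) * offDiagEntry m k (i.1 + 2))) ∧
    -- the Hamiltonian is a self-adjoint operator
    (initialHamiltonian ħ I₁ δ c₁ c₂ m k).IsClosable ∧
    IsSelfAdjoint (hamiltonian ħ I₁ δ c₁ c₂ m k) ∧
    -- the Wigner functions form an orthonormal basis in which the matrix represents it
    (∃ b : HilbertBasis (Level m k) ℂ Wave,
      (∀ j : Level m k,
        (b j : ℝ → ℂ) =ᵐ[thetaMeasure] fun θ => (wignerTheta m k j.1 θ : ℂ)) ∧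
      (∀ j : Level m k, ∃ h : b j ∈ (hamiltonian ħ I₁ δ 0 0 m k).domain,
        hamiltonian ħ I₁ δ 0 0 m k ⟨b j, h⟩ = (H0 ħ I₁ δ m k j j : ℂ) • b j) ∧
      (∀ i j : Level m k, ∃ h : b j ∈ (hamiltonian ħ I₁ δ c₁ c₂ m k).domain,
        inner ℂ (b i) (hamiltonian ħ I₁ δ c₁ c₂ m k ⟨b j, h⟩)
          = (topMatrix ħ I₁ δ c₁ c₂ m k i j : ℂ)) ∧
      (∀ f g : Wave,
        (f, g) ∈ (hamiltonian ħ I₁ δ c₁ c₂ m k).graph ↔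
          (b.repr f, b.repr g) ∈ (matrixOperator (topMatrix ħ I₁ δ c₁ c₂ m k)).graph)) ∧
    -- the spectrum is the spectrum of the matrix, and it consists of the matrix's eigenvalues
    spectrumOf (hamiltonian ħ I₁ δ c₁ c₂ m k)
      = spectrumOf (matrixOperator (topMatrix ħ I₁ δ c₁ c₂ m k)) ∧
    (∀ z : ℂ, z ∈ spectrumOf (hamiltonian ħ I₁ δ c₁ c₂ m k) ↔
      ∃ x : lp (fun _ : Level m k => ℂ) 2, x ≠ 0 ∧
        ∀ i, HasSum (fun j => (topMatrix ħ I₁ δ c₁ c₂ m k i j : ℂ) * x j) (z * x i)) := by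
  have hlevel : ∀ j : Level m k, ∃ n, j.1 = n + minLevel m k := fun j =>
    ⟨levelEquiv m k j, (levelEquiv_add m k j).symm⟩
  refine ⟨fun f _ φ ψ θ _ => ⟨?_, ?_, ?_, ?_⟩, fun E u hu => ⟨fun h z hz => ?_, fun h θ hθ => ?_⟩,
    fun j φ ψ θ hθ => ⟨?_, ?_, ?_⟩, fun i j => ?_, fun i j => ?_, isSymm_topMatrix ħ I₁ δ c₁ c₂ m k,
    fun i j => topMatrix_eq_zero ħ I₁ δ c₁ c₂, fun i j => topMatrix_add_two ħ I₁ δ c₁ c₂,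
    (graph_hamiltonian ħ I₁ δ c₁ c₂ m k).1,
    isSelfAdjoint_of_graph_eq (graph_hamiltonian ħ I₁ δ c₁ c₂ m k).2 (potentialOp_symm c₁ c₂),
    ⟨wignerBasis m k, coeFn_wignerBasis m k, fun j => ?_, fun i j => ?_,
      mem_graph_hamiltonian_iff_matrixOperator ħ I₁ δ c₁ c₂ m k⟩, ?_,
    mem_spectrumOf_hamiltonian_iff hħ hI₁ δ c₁ c₂ m k⟩
  · rw [lz_sectorFun]
  · rw [L3_sectorFun]
  · rw [lSq_sectorFun]
  · rw [topHamiltonian_sectorFun]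
  · have hθ : Real.arccos z ∈ Set.Ioo 0 Real.pi :=
      ⟨Real.arccos_pos.2 hz.2, Real.arccos_lt_pi.2 hz.1⟩
    have := (reducedHamiltonian_eq_iff_heunOperator hħ hI₁ δ c₁ c₂ m k E hu hθ).1 (h _ hθ)
    rwa [Real.cos_arccos hz.1.le hz.2.le] at this
  · refine (reducedHamiltonian_eq_iff_heunOperator hħ hI₁ δ c₁ c₂ m k E hu hθ).2 (h _ ⟨?_, ?_⟩)
    · have := Real.cos_lt_cos_of_nonneg_of_le_pi hθ.1.le le_rfl hθ.2
      rwa [Real.cos_pi] at this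
    · have := Real.cos_lt_cos_of_nonneg_of_le_pi le_rfl hθ.2.le hθ.1
      rwa [Real.cos_zero] at this
  · rw [wignerD, lz_sectorFun]
  · rw [wignerD, L3_sectorFun]
  · obtain ⟨n, hn⟩ := hlevel j
    rw [wignerD, lSq_sectorFun, hn]
    simp only [sectorFun]
    rw [lSqReduced_wignerTheta m k n hθ]
    ring
  · have h := inner_wignerBasis_eq_integral (m := m) (k := k) i j coeFn_cosOp
    rw [inner_wignerBasis_cosOp] at h
    exact (Complex.ofReal_injective h).symm
  · have hv : ∀ f : Wave, ((cosOp ∘L cosOp) f : ℝ → ℂ) =ᵐ[thetaMeasure]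
        fun θ => ((Real.cos θ ^ 2 : ℝ) : ℂ) * f θ := fun f => by
      filter_upwards [coeFn_cosOp_pow f 2] with θ h1
      rw [Complex.ofReal_pow, ← h1, pow_two]
      rfl
    have h := inner_wignerBasis_eq_integral (m := m) (k := k) i j hv
    rw [ContinuousLinearMap.comp_apply, inner_wignerBasis_cosOp_sq] at h
    exact (Complex.ofReal_injective h).symm
  · obtain ⟨h, h1⟩ := hamiltonian_wignerBasis ħ I₁ δ 0 0 m k j
    refine ⟨h, ?_⟩
    rw [h1, H0_apply, if_pos rfl, potentialOp_apply]
    simp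
  · obtain ⟨h, h1⟩ := hamiltonian_wignerBasis ħ I₁ δ c₁ c₂ m k j
    exact ⟨h, by rw [h1, topMatrix_eq_inner]⟩
  · exact spectrumOf_eq_of_equiv (wignerBasis m k).repr.toContinuousLinearEquiv
      (mem_graph_hamiltonian_iff_matrixOperator ħ I₁ δ c₁ c₂ m k)
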